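/- Let $d\ge 3$, $\gamma>0$ and $\omega\in\mathbb R$ with $|\omega|<1$. For $p>1$ and $\phi\in H^1(\mathbb R^d)=H^1(\mathbb R^d;\mathbb C)$ put $$\|(-\Delta_\gamma)^{1/2}\phi\|_{L^2}^2:=\|\nabla\phi\|_{L^2}^2+\int_{\mathbb R^d}\frac{\gamma}{|x|^2}|\phi(x)|^2\,dx,$$ $$S_{\omega,\gamma}(\phi):=\frac{1-\omega^2}{2}\|\phi\|_{L^2}^2+\frac12\|(-\Delta_\gamma)^{1/2}\phi\|_{L^2}^2-\frac1{p+1}\|\phi\|_{L^{p+1}}^{p+1},$$ and, for $(\alpha,\beta)\in\mathbb R^2$, $$K^{\alpha,\beta}_{\omega,\gamma}(\phi):=\frac{d}{d\lambda}\Big|_{\lambda=0}S_{\omega,\gamma}\big(e^{\alpha\lambda}\phi(e^{\beta\lambda}\,\cdot\,)\big),$$ $$r^{\alpha,\beta}_{\omega,\gamma}:=\inf\{S_{\omega,\gamma}(\phi):\phi\in H^1_{\mathrm{rad}}(\mathbb R^d)\setminus\{0\},\ K^{\alpha,\beta}_{\omega,\gamma}(\phi)=0\},$$ where $H^1_{\mathrm{rad}}(\mathbb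 R^d)$ is the set of radial functions in $H^1(\mathbb R^d)$. We say that $r^{\alpha,\beta}_{\omega,\gamma}$ has a minimizer if the infimum is attained, i.e. there is $\phi\in H^1_{\mathrm{rad}}(\mathbb R^d)\setminus\{0\}$ with $K^{\alpha,\beta}_{\omega,\gamma}(\phi)=0$ and $S_{\omega,\gamma}(\phi)=r^{\alpha,\beta}_{\omega,\gamma}$. Then: 1. if $1+\frac4d\le p<1+\frac4{d-2}$, then $r^{d,2}_{\omega,\gamma}$ has a minimizer; 2. if $1<p<1+\frac4d$, then $r^{2,p-1}_{\omega,\gamma}$ has a minimizer and $r^{0,-1}_{\omega,\gamma}$ has a minimizer. -/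

import Mathlib

open MeasureTheory

noncomputable section

namespace NLKG

/-- The Euclidean space `ℝ^d`. -/
abbrev Space (d : ℕ) := EuclideanSpace ℝ (Fin d)

/-- `G` is a weak (distributional) gradient of `f`, tested against `C_c^∞(ℝ^d)`. -/
def IsWeakGradient {d : ℕ} (f : Space d → ℂ) (G : Space d → EuclideanSpace ℂ (Fin d)) : Prop :=
  ∀ φ : Space d → ℝ, ContDiff ℝ (⊤ : ℕ∞) φ → HasCompactSupport φ → ∀ i : Fin d,
    ∫ x, (fderiv ℝ φ x (EuclideanSpace.single i 1)) • f x = -∫ x, φ x • G x i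

/-- `f` has a weak gradient in `L²(ℝ^d)`. -/
def HasL2WeakGradient {d : ℕ} (f : Space d → ℂ) : Prop :=
  ∃ G : Space d → EuclideanSpace ℂ (Fin d), MemLp G 2 volume ∧ IsWeakGradient f G

/-- `f` is (a representative of) an element of the Sobolev space `H¹(ℝ^d)`. -/
def MemH1 {d : ℕ} (f : Space d → ℂ) : Prop :=
  MemLp f 2 volume ∧ HasL2WeakGradient f

open Classical in
/-- The weak gradient in `L²` (unique up to null sets, see `IsWeakGradient.ae_eq`);
zero by convention if there is none. -/
def weakGradient {d : ℕ} (f : Space d → ℂ) : Space d → EuclideanSpace ℂ (Fin d) :=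
  if h : HasL2WeakGradient f then h.choose else 0

/-- The class of `f` modulo null sets has a radial representative. -/
def IsRadial {d : ℕ} (f : Space d → ℂ) : Prop :=
  ∃ g : ℝ → ℂ, f =ᵐ[volume] fun x => g ‖x‖

/-- `f ∈ H¹_rad(ℝ^d) \ {0}`. -/
def MemH1RadNonzero {d : ℕ} (f : Space d → ℂ) : Prop :=
  MemH1 f ∧ IsRadial f ∧ ¬ f =ᵐ[volume] 0

/-- `‖(-Δ_γ)^{1/2} f‖²_{L²} = ‖∇f‖²_{L²} + ∫ γ |x|⁻² |f|²`, the quadratic form of `-Δ + γ|x|⁻²`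
(for `d ≥ 3` both integrals are finite on `H¹`, by Hardy's inequality). -/
def potentialForm {d : ℕ} (γ : ℝ) (f : Space d → ℂ) : ℝ :=
  (∫ x, ‖weakGradient f x‖ ^ 2) + ∫ x, γ / ‖x‖ ^ 2 * ‖f x‖ ^ 2

/-- The action `S_{ω,γ}` with the power nonlinearity of exponent `p`. -/
def action {d : ℕ} (p ω γ : ℝ) (f : Space d → ℂ) : ℝ :=
  (1 - ω ^ 2) / 2 * (∫ x, ‖f x‖ ^ 2) + 1 / 2 * potentialForm γ f
    - 1 / (p + 1) * ∫ x, ‖f x‖ ^ (p + 1)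

/-- The rescaled function `e^{αs} f(e^{βs} ·)`. -/
def rescale {d : ℕ} (α β s : ℝ) (f : Space d → ℂ) : Space d → ℂ :=
  fun x => Real.exp (α * s) • f (Real.exp (β * s) • x)

/-- `K_{ω,γ}^{α,β}(f) = d/ds|_{s=0} S_{ω,γ}(e^{αs} f(e^{βs} ·))`
(the derivative exists for every `f ∈ H¹`, see `hasDerivAt_action_rescale`). -/
def virial {d : ℕ} (p ω γ α β : ℝ) (f : Space d → ℂ) : ℝ :=
  deriv (fun s : ℝ => action p ω γ (rescale α β s f)) 0

/-- The constraint set `{φ ∈ H¹_rad \ {0} : K_{ω,γ}^{α,β}(φ) = 0}`. -/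
def constraintSet (d : ℕ) (p ω γ α β : ℝ) : Set (Space d → ℂ) :=
  {φ | MemH1RadNonzero φ ∧ virial p ω γ α β φ = 0}

/-- `r_{ω,γ}^{α,β}`, the infimum of the action over the constraint set. -/
def radialInf (d : ℕ) (p ω γ α β : ℝ) : ℝ :=
  sInf (action p ω γ '' constraintSet d p ω γ α β)

/-- `φ` is a minimizer of `r_{ω,γ}^{α,β}`: it satisfies the constraint, its action is
`r_{ω,γ}^{α,β}`, and this is a lower bound of the action on the constraint set (so that the real
infimum is a genuine one). -/
def IsRadialMinimizer {d : ℕ} (p ω γ α β : ℝ) (φ : Space d → ℂ) : Prop :=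
  φ ∈ constraintSet d p ω γ α β ∧ action p ω γ φ = radialInf d p ω γ α β ∧
    ∀ ψ ∈ constraintSet d p ω γ α β, radialInf d p ω γ α β ≤ action p ω γ ψ

/-! The gradient and the virial functional are well defined on `H¹`. -/

theorem locallyIntegrable_coord {d : ℕ} {G : Space d → EuclideanSpace ℂ (Fin d)}
    (hG : MemLp G 2 volume) (i : Fin d) : LocallyIntegrable (fun x => G x i) volume := by
  have h : MemLp (fun x => G x i) 2 volume :=
    hG.of_le ((EuclideanSpace.proj (𝕜 := ℂ) i).continuous.comp_aestronglyMeasurable hG.1)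
      (Filter.Eventually.of_forall fun x => PiLp.norm_apply_le (G x) i)
  exact h.locallyIntegrable one_le_two

theorem IsWeakGradient.ae_eq {d : ℕ} {f : Space d → ℂ}
    {G G' : Space d → EuclideanSpace ℂ (Fin d)} (hG : MemLp G 2 volume) (hG' : MemLp G' 2 volume)
    (h : IsWeakGradient f G) (h' : IsWeakGradient f G') : G =ᵐ[volume] G' := by
  have key : ∀ i : Fin d, ∀ᵐ x, G x i = G' x i := fun i =>
    ae_eq_of_integral_contDiff_smul_eq (locallyIntegrable_coord hG i)
      (locallyIntegrable_coord hG' i) fun φ hφ hc =>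
        neg_injective ((h φ hφ hc i).symm.trans (h' φ hφ hc i))
  filter_upwards [ae_all_iff.2 key] with x hx
  ext i
  exact hx i

theorem weakGradient_ae_eq {d : ℕ} {f : Space d → ℂ} {G : Space d → EuclideanSpace ℂ (Fin d)}
    (hG : MemLp G 2 volume) (h : IsWeakGradient f G) : weakGradient f =ᵐ[volume] G := by
  have hf : HasL2WeakGradient f := ⟨G, hG, h⟩
  rw [weakGradient, dif_pos hf]
  exact IsWeakGradient.ae_eq hf.choose_spec.1 hG hf.choose_spec.2 h

theorem memLp_comp_smul {d : ℕ} {F : Type*} [NormedAddCommGroup F] {G : Space d → F}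
    (hG : MemLp G 2 volume) {b : ℝ} (hb : b ≠ 0) : MemLp (fun x => G (b • x)) 2 volume := by
  have h : MemLp G 2 (Measure.map (b • ·) (volume : Measure (Space d))) := by
    rw [Measure.map_addHaar_smul volume hb]
    exact hG.smul_measure ENNReal.ofReal_ne_top
  exact h.comp_of_map (measurable_const_smul b).aemeasurable

theorem IsWeakGradient.rescale {d : ℕ} {f : Space d → ℂ}
    {G : Space d → EuclideanSpace ℂ (Fin d)} (h : IsWeakGradient f G) (a : ℝ) {b : ℝ}
    (hb : 0 < b) :
    IsWeakGradient (fun x => a • f (b • x)) (fun x => (a * b) • G (b • x)) := by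
  intro φ hφ hc i
  have hb' : b ≠ 0 := hb.ne'
  set ψ : Space d → ℝ := fun x => φ (b⁻¹ • x) with hψ
  have hψd : ContDiff ℝ (⊤ : ℕ∞) ψ := hφ.comp (contDiff_const_smul _)
  have hψc : HasCompactSupport ψ := hc.comp_homeomorph (Homeomorph.smulOfNeZero b⁻¹ (inv_ne_zero hb'))
  have hψf : ∀ x v, fderiv ℝ ψ (b • x) v = b⁻¹ * fderiv ℝ φ x v := by
    intro x v
    have h1 := fderiv_comp_smul (𝕜 := ℝ) (f := φ) b⁻¹ (x := b • x)
    rw [hψ, h1]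
    simp [smul_smul, hb']
  have := h ψ hψd hψc i
  have e1 := Measure.integral_comp_smul (volume : Measure (Space d))
    (fun x => (fderiv ℝ ψ x (EuclideanSpace.single i 1)) • f x) b
  have e2 := Measure.integral_comp_smul (volume : Measure (Space d))
    (fun x => ψ x • G x i) b
  rw [this, smul_neg, ← e2] at e1
  have hψx : ∀ x, ψ (b • x) = φ x := fun x => by simp [hψ, smul_smul, hb']
  simp only [hψf, hψx] at e1
  calc ∫ x, (fderiv ℝ φ x (EuclideanSpace.single i 1)) • a • f (b • x)
      = (a * b) • ∫ x, (b⁻¹ * fderiv ℝ φ x (EuclideanSpace.single i 1)) • f (b • x) := by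
        rw [← integral_smul]
        refine integral_congr_ae (Filter.Eventually.of_forall fun x => ?_)
        simp only [smul_smul]
        congr 1
        field_simp
    _ = -∫ x, φ x • ((a * b) • G (b • x)) i := by
        rw [e1, smul_neg, ← integral_smul]
        congr 1
        refine integral_congr_ae (Filter.Eventually.of_forall fun x => ?_)
        simp only [PiLp.smul_apply]
        rw [smul_comm]

theorem integral_weakGradient_rescale {d : ℕ} {f : Space d → ℂ} (hf : HasL2WeakGradient f)
    (α β s : ℝ) :
    ∫ x, ‖weakGradient (rescale α β s f) x‖ ^ 2 =
      Real.exp ((2 * α - (d - 2) * β) * s) * ∫ x, ‖weakGradient f x‖ ^ 2 := by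
  obtain ⟨G, hG, h⟩ := hf
  have hb := Real.exp_pos (β * s)
  have h1 := weakGradient_ae_eq ((memLp_comp_smul hG hb.ne').const_smul
    (Real.exp (α * s) * Real.exp (β * s))) (h.rescale (Real.exp (α * s)) hb)
  have h2 := weakGradient_ae_eq hG h
  have e1 : ∫ x, ‖weakGradient (rescale α β s f) x‖ ^ 2 =
      ∫ x, (Real.exp (α * s) * Real.exp (β * s)) ^ 2 * ‖G (Real.exp (β * s) • x)‖ ^ 2 := by
    refine integral_congr_ae ?_
    filter_upwards [h1] with x hx
    have hx' : weakGradient (rescale α β s f) x =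
      (Real.exp (α * s) * Real.exp (β * s)) • G (Real.exp (β * s) • x) := hx
    rw [hx', norm_smul, mul_pow, Real.norm_eq_abs, sq_abs]
  have e2 : ∫ x, ‖weakGradient f x‖ ^ 2 = ∫ x, ‖G x‖ ^ 2 := by
    refine integral_congr_ae ?_
    filter_upwards [h2] with x hx
    rw [hx]
  rw [e1, e2, integral_const_mul, Measure.integral_comp_smul_of_nonneg volume
    (fun x => ‖G x‖ ^ 2) (hR := hb.le), finrank_euclideanSpace_fin, smul_eq_mul, ← mul_assoc]
  congr 1
  rw [← Real.exp_add, ← Real.exp_nat_mul, ← Real.exp_nat_mul, ← Real.exp_neg, ← Real.exp_add]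
  congr 1
  push_cast
  ring

theorem integral_norm_rpow_rescale {d : ℕ} (f : Space d → ℂ) (α β s q : ℝ) :
    ∫ x, ‖rescale α β s f x‖ ^ q = Real.exp ((q * α - d * β) * s) * ∫ x, ‖f x‖ ^ q := by
  have hb := Real.exp_pos (β * s)
  have e1 : ∀ x, ‖rescale α β s f x‖ ^ q =
      Real.exp (α * s) ^ q * ‖f (Real.exp (β * s) • x)‖ ^ q := by
    intro x
    rw [rescale, norm_smul, Real.norm_eq_abs, Real.abs_exp,
      Real.mul_rpow (Real.exp_pos _).le (norm_nonneg _)]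
  simp only [e1]
  rw [integral_const_mul, Measure.integral_comp_smul_of_nonneg volume
    (fun x => ‖f x‖ ^ q) (hR := hb.le), finrank_euclideanSpace_fin, smul_eq_mul, ← mul_assoc]
  congr 1
  rw [← Real.exp_mul, ← Real.exp_nat_mul, ← Real.exp_neg, ← Real.exp_add]
  congr 1
  ring

theorem integral_potential_rescale {d : ℕ} (f : Space d → ℂ) (γ α β s : ℝ) :
    ∫ x, γ / ‖x‖ ^ 2 * ‖rescale α β s f x‖ ^ 2 =
      Real.exp ((2 * α - (d - 2) * β) * s) * ∫ x, γ / ‖x‖ ^ 2 * ‖f x‖ ^ 2 := by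
  have hb := Real.exp_pos (β * s)
  have e1 : ∀ x, γ / ‖x‖ ^ 2 * ‖rescale α β s f x‖ ^ 2 =
      (Real.exp (α * s) * Real.exp (β * s)) ^ 2 *
        (γ / ‖Real.exp (β * s) • x‖ ^ 2 * ‖f (Real.exp (β * s) • x)‖ ^ 2) := by
    intro x
    rw [rescale, norm_smul, norm_smul, Real.norm_eq_abs, Real.abs_exp, Real.norm_eq_abs,
      Real.abs_exp, mul_pow, mul_pow, mul_pow, mul_comm (Real.exp (β * s) ^ 2), ← div_div]
    field_simp
  simp only [e1]
  rw [integral_const_mul, Measure.integral_comp_smul_of_nonneg volume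
    (fun x => γ / ‖x‖ ^ 2 * ‖f x‖ ^ 2) (hR := hb.le), finrank_euclideanSpace_fin, smul_eq_mul,
    ← mul_assoc]
  congr 1
  rw [← Real.exp_add, ← Real.exp_nat_mul, ← Real.exp_nat_mul, ← Real.exp_neg, ← Real.exp_add]
  congr 1
  push_cast
  ring

theorem hasDerivAt_action_rescale {d : ℕ} {f : Space d → ℂ} (hf : MemH1 f) (p ω γ α β : ℝ) :
    HasDerivAt (fun s : ℝ => action p ω γ (rescale α β s f))
      ((1 - ω ^ 2) / 2 * (2 * α - d * β) * (∫ x, ‖f x‖ ^ 2)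
        + 1 / 2 * (2 * α - (d - 2) * β) * potentialForm γ f
        - 1 / (p + 1) * ((p + 1) * α - d * β) * ∫ x, ‖f x‖ ^ (p + 1)) 0 := by
  have hE : ∀ c : ℝ, HasDerivAt (fun s : ℝ => Real.exp (c * s)) c 0 := by
    intro c
    have := ((hasDerivAt_id (0 : ℝ)).const_mul c).exp
    simpa using this
  have h2 : ∀ s : ℝ, ∫ x, ‖rescale α β s f x‖ ^ 2 =
      Real.exp ((2 * α - d * β) * s) * ∫ x, ‖f x‖ ^ 2 := by
    intro s
    have := integral_norm_rpow_rescale f α β s 2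
    simpa only [Real.rpow_two] using this
  have e : (fun s : ℝ => action p ω γ (rescale α β s f)) = fun s : ℝ =>
      (1 - ω ^ 2) / 2 * (Real.exp ((2 * α - d * β) * s) * ∫ x, ‖f x‖ ^ 2)
        + 1 / 2 * (Real.exp ((2 * α - (d - 2) * β) * s) * potentialForm γ f)
        - 1 / (p + 1) * (Real.exp (((p + 1) * α - d * β) * s) * ∫ x, ‖f x‖ ^ (p + 1)) := by
    funext s
    rw [action, h2, integral_norm_rpow_rescale, potentialForm,
      integral_weakGradient_rescale hf.2, integral_potential_rescale, ← mul_add]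
    rfl
  rw [e]
  have := ((((hE (2 * α - d * β)).mul_const (∫ x, ‖f x‖ ^ 2)).const_mul ((1 - ω ^ 2) / 2)).add
    (((hE (2 * α - (d - 2) * β)).mul_const (potentialForm γ f)).const_mul (1 / 2))).sub
    (((hE ((p + 1) * α - d * β)).mul_const (∫ x, ‖f x‖ ^ (p + 1))).const_mul (1 / (p + 1)))
  exact this.congr_deriv (by ring)

end NLKG

end

/-! Write M for the mass, P for `potentialForm` and N for the integral of |φ|^(p+1). Action and
constraint depend on φ only through (M, P, N). Since |x|⁻² has the homogeneity of the Laplacian,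
gradient and potential energies scale alike, so the two-parameter scaling moves M and P to any
prescribed positive values. Everything therefore follows from one radial Gagliardo-Nirenberg
inequality N ≤ C M^a P^b, with b = d(p-1)/4 and a + b = (p+1)/2, attained at every pair (M, P)
(`exists_gagliardoNirenberg_optimizer`). On the constraint set N can be eliminated: the action
becomes a linear function of M and P, and the inequality becomes a condition on (M, P) alone.
Weighted AM-GM solves this two-variable problem (`exists_min_first`, `exists_min_sum`) with equality
in the condition, and an optimizer with these values of M and P is a minimizer.

The optimizer comes from compactness. A radial H¹ function is recovered from its gradient by φ(x) =
-|S|⁻¹ ∫_{|y|>|x|} |y|^(-d) y·∇φ(y) dy (`ae_eq_profile`), an L² pairing with a fixed kernel. Hence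
weak convergence of gradients forces pointwise convergence, and Cauchy-Schwarz gives the decay
|φ(x)| ≤ c |x|^(-(d-2)/2). This envelope dominates |φ|^(p+1) near the origin because p is
energy-subcritical, and it makes the tails uniformly small because p > 1. So N passes to the limit
(`exists_limit_of_normalized`), while mass and energy can only drop. -/

namespace NLKG

open Set Filter Topology

/-! ### Polar coordinates and integrals of powers of the norm -/

/-- The area of the unit sphere of `ℝ^d`. -/
noncomputable def sphereArea (d : ℕ) : ℝ := d * volume.real (Metric.ball (0 : Space d) 1)

theorem sphereArea_pos {d : ℕ} (hd : 3 ≤ d) : 0 < sphereArea d := by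
  have : (0 : ℝ) < d := by exact_mod_cast (by omega : 0 < d)
  have h : 0 < volume.real (Metric.ball (0 : Space d) 1) :=
    ENNReal.toReal_pos (Metric.measure_ball_pos volume _ one_pos).ne' measure_ball_lt_top.ne
  exact mul_pos this h

theorem nontrivial_space {d : ℕ} (hd : 3 ≤ d) : Nontrivial (Space d) := by
  apply Module.nontrivial_of_finrank_pos (R := ℝ)
  rw [finrank_euclideanSpace_fin]
  omega

theorem integral_radial {d : ℕ} (hd : 3 ≤ d) {F : Type*} [NormedAddCommGroup F] [NormedSpace ℝ F]
    (f : ℝ → F) :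
    ∫ x : Space d, f ‖x‖ = sphereArea d • ∫ r in Ioi (0 : ℝ), r ^ (d - 1) • f r := by
  have := nontrivial_space hd
  rw [integral_fun_norm_addHaar volume f, finrank_euclideanSpace_fin, sphereArea, mul_smul,
    Nat.cast_smul_eq_nsmul]

theorem integrable_radial {d : ℕ} (hd : 3 ≤ d) {F : Type*} [NormedAddCommGroup F]
    [NormedSpace ℝ F] {f : ℝ → F} :
    Integrable (fun x : Space d => f ‖x‖) ↔
      IntegrableOn (fun r : ℝ => r ^ (d - 1) • f r) (Ioi 0) := by
  have := nontrivial_space hd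
  rw [integrable_fun_norm_addHaar volume, finrank_euclideanSpace_fin]

/-- In polar coordinates the indicator of a null set of radii has integral zero. -/
theorem ae_norm_of_ae_Ioi {d : ℕ} (hd : 3 ≤ d) {p : ℝ → Prop}
    (h : ∀ᵐ r ∂(volume.restrict (Ioi (0 : ℝ))), p r) : ∀ᵐ x : Space d, p ‖x‖ := by
  obtain ⟨N, hN, hNm, hN0⟩ := exists_measurable_superset_of_null (ae_iff.1 h)
  have h0 : (fun r : ℝ => r ^ (d - 1) • N.indicator (fun _ => (1 : ℝ)) r)
      =ᵐ[volume.restrict (Ioi 0)] 0 := by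
    filter_upwards [measure_eq_zero_iff_ae_notMem.1 hN0] with r hr
    simp [hr]
  have hi : Integrable (fun x : Space d => N.indicator (fun _ => (1 : ℝ)) ‖x‖) :=
    (integrable_radial hd).2 ((integrable_zero _ _ _).congr h0.symm)
  have hz := integral_radial hd (N.indicator (fun _ => (1 : ℝ)))
  rw [integral_congr_ae h0] at hz
  simp only [Pi.zero_apply, integral_zero, smul_zero] at hz
  rw [integral_eq_zero_iff_of_nonneg
    (fun x => indicator_nonneg (fun _ _ => zero_le_one) _) hi] at hz
  filter_upwards [hz] with x hx
  by_contra hp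
  have : ‖x‖ ∈ N := hN hp
  simp [this] at hx

theorem rpow_mul_pow_pred {d : ℕ} (hd : 3 ≤ d) {r : ℝ} (hr : 0 < r) (q : ℝ) :
    r ^ (d - 1) * r ^ q = r ^ ((d : ℝ) - 1 + q) := by
  rw [← Real.rpow_natCast, ← Real.rpow_add hr, Nat.cast_sub (by omega), Nat.cast_one]

theorem integrable_norm_rpow_outside {d : ℕ} (hd : 3 ≤ d) {q R : ℝ} (hq : (d : ℝ) + q < 0)
    (hR : 0 < R) :
    Integrable fun x : Space d => (Ioi R).indicator (fun r : ℝ => r ^ q) ‖x‖ := by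
  refine (integrable_radial hd (f := (Ioi R).indicator fun r : ℝ => r ^ q)).2 ?_
  have h : IntegrableOn (fun r : ℝ => r ^ ((d : ℝ) - 1 + q)) (Ioi R) :=
    integrableOn_Ioi_rpow_of_lt (by linarith) hR
  rw [← integrable_indicator_iff measurableSet_Ioi] at h
  refine h.integrableOn.congr_fun (fun r hr => ?_) measurableSet_Ioi
  by_cases h' : r ∈ Ioi R
  · simp only [indicator_of_mem h', smul_eq_mul, rpow_mul_pow_pred hd hr]
  · simp [indicator_of_notMem h']

theorem integral_norm_rpow_outside {d : ℕ} (hd : 3 ≤ d) {q R : ℝ} (hq : (d : ℝ) + q < 0)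
    (hR : 0 < R) :
    ∫ x : Space d, (Ioi R).indicator (fun r : ℝ => r ^ q) ‖x‖ =
      sphereArea d / (-((d : ℝ) + q)) * R ^ ((d : ℝ) + q) := by
  rw [integral_radial hd]
  have : ∫ r in Ioi (0 : ℝ), r ^ (d - 1) • (Ioi R).indicator (fun r : ℝ => r ^ q) r
      = ∫ r in Ioi R, r ^ ((d : ℝ) - 1 + q) := by
    rw [← integral_indicator measurableSet_Ioi, ← integral_indicator measurableSet_Ioi]
    congr 1
    ext r
    by_cases h' : r ∈ Ioi R
    · have h0 : 0 < r := hR.trans h'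
      simp only [indicator_of_mem h', indicator_of_mem (mem_Ioi.2 h0), smul_eq_mul,
        rpow_mul_pow_pred hd h0]
    · by_cases h0 : r ∈ Ioi (0 : ℝ) <;> simp [indicator_of_notMem h']
  rw [this, integral_Ioi_rpow_of_lt (by linarith) hR, smul_eq_mul,
    show (d : ℝ) - 1 + q + 1 = d + q by ring]
  rw [div_neg, neg_mul, ← mul_div_right_comm, mul_div_assoc, mul_comm, neg_div]
  ring

theorem integrable_norm_rpow_inside {d : ℕ} (hd : 3 ≤ d) {q R : ℝ} (hq : 0 < (d : ℝ) + q)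
    (hR : 0 < R) :
    Integrable fun x : Space d => (Iio R).indicator (fun r : ℝ => r ^ q) ‖x‖ := by
  refine (integrable_radial hd (f := (Iio R).indicator fun r : ℝ => r ^ q)).2 ?_
  have h : IntegrableOn (fun r : ℝ => r ^ ((d : ℝ) - 1 + q)) (Ioo 0 R) :=
    (intervalIntegral.integrableOn_Ioo_rpow_iff hR).2 (by linarith)
  rw [← integrable_indicator_iff measurableSet_Ioo] at h
  refine h.integrableOn.congr_fun (fun r hr => ?_) measurableSet_Ioi
  by_cases h' : r ∈ Iio R
  · simp only [indicator_of_mem h', smul_eq_mul, rpow_mul_pow_pred hd hr,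
      indicator_of_mem (show r ∈ Ioo 0 R from ⟨hr, h'⟩)]
  · have : r ∉ Ioo 0 R := fun h => h' h.2
    simp [indicator_of_notMem h', indicator_of_notMem this]

theorem integral_norm_rpow_inside {d : ℕ} (hd : 3 ≤ d) {q R : ℝ} (hq : 0 < (d : ℝ) + q)
    (hR : 0 < R) :
    ∫ x : Space d, (Iio R).indicator (fun r : ℝ => r ^ q) ‖x‖ =
      sphereArea d / ((d : ℝ) + q) * R ^ ((d : ℝ) + q) := by
  rw [integral_radial hd]
  have : ∫ r in Ioi (0 : ℝ), r ^ (d - 1) • (Iio R).indicator (fun r : ℝ => r ^ q) r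
      = ∫ r in Ioo 0 R, r ^ ((d : ℝ) - 1 + q) := by
    rw [← integral_indicator measurableSet_Ioi, ← integral_indicator measurableSet_Ioo]
    congr 1
    ext r
    by_cases h0 : r ∈ Ioi (0 : ℝ)
    · by_cases h' : r ∈ Iio R
      · simp only [indicator_of_mem h', indicator_of_mem h0, smul_eq_mul,
          rpow_mul_pow_pred hd h0, indicator_of_mem (show r ∈ Ioo 0 R from ⟨h0, h'⟩)]
      · have : r ∉ Ioo 0 R := fun h => h' h.2
        simp [indicator_of_notMem h', indicator_of_notMem this]
    · have : r ∉ Ioo 0 R := fun h => h0 h.1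
      simp only [indicator_of_notMem this, indicator_of_notMem h0]
  rw [this, ← integral_Ioc_eq_integral_Ioo, ← intervalIntegral.integral_of_le hR.le,
    integral_rpow (Or.inl (by linarith)), show (d : ℝ) - 1 + q + 1 = d + q by ring,
    Real.zero_rpow hq.ne', smul_eq_mul]
  ring


/-! ### Distributional derivatives on the half line and radial test fields -/

theorem exists_Icc_of_isCompact_subset_Ioi {K : Set ℝ} (hK : IsCompact K) (h0 : K ⊆ Ioi 0) :
    ∃ a b : ℝ, 0 < a ∧ a ≤ b ∧ K ⊆ Icc a b := by
  rcases K.eq_empty_or_nonempty with rfl | hne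
  · exact ⟨1, 1, one_pos, le_rfl, empty_subset _⟩
  · obtain ⟨a, haK, ha⟩ := hK.exists_isLeast hne
    obtain ⟨b, -, hb⟩ := hK.exists_isGreatest hne
    exact ⟨a, b, h0 haK, hb haK, fun x hx => ⟨ha hx, hb hx⟩⟩

theorem integrable_smul_of_locallyIntegrableOn {u : ℝ → ℂ} (hu : LocallyIntegrableOn u (Ioi 0))
    {ψ : ℝ → ℝ} (hψ : Continuous ψ) (hc : HasCompactSupport ψ) (h0 : tsupport ψ ⊆ Ioi 0) :
    Integrable fun r => ψ r • u r := by
  have h1 : IntegrableOn u (tsupport ψ) := hu.integrableOn_compact_subset h0 hc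
  have h2 := h1.continuousOn_smul hψ.continuousOn hc
  refine (integrableOn_iff_integrable_of_support_subset fun r hr => ?_).1 h2
  exact subset_tsupport _ fun h => hr (by simp [h])

/-- The du Bois-Reymond lemma on the half line. -/
theorem ae_eq_const_of_integral_deriv_smul_eq_zero {u : ℝ → ℂ}
    (hu : LocallyIntegrableOn u (Ioi 0))
    (h : ∀ ζ : ℝ → ℝ, ContDiff ℝ (⊤ : ℕ∞) ζ → HasCompactSupport ζ → tsupport ζ ⊆ Ioi 0 →
      ∫ r, deriv ζ r • u r = 0) :
    ∃ c : ℂ, ∀ᵐ r, r ∈ Ioi (0 : ℝ) → u r = c := by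
  let B : ContDiffBump (2 : ℝ) := ⟨1 / 2, 1, by norm_num, by norm_num⟩
  set ψ₀ : ℝ → ℝ := B.normed volume with hψ₀
  have d₀ : ContDiff ℝ (⊤ : ℕ∞) ψ₀ := B.contDiff_normed
  have c₀ : HasCompactSupport ψ₀ := B.hasCompactSupport_normed
  have s₀ : tsupport ψ₀ ⊆ Ioi 0 := by
    rw [hψ₀, B.tsupport_normed_eq, Real.closedBall_eq_Icc]
    intro x hx
    have : (2 : ℝ) - 1 ≤ x := hx.1
    exact mem_Ioi.2 (by linarith)
  have i₀ : ∫ r, ψ₀ r = 1 := B.integral_normed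
  -- The constant is forced: it is what u gives when tested against a bump of integral one.
  refine ⟨∫ r, ψ₀ r • u r, ?_⟩
  have hu' : LocallyIntegrableOn (fun r => u r - ∫ r, ψ₀ r • u r) (Ioi 0) :=
    hu.sub ((locallyIntegrable_const _).locallyIntegrableOn _)
  have key := isOpen_Ioi.ae_eq_zero_of_integral_contDiff_smul_eq_zero hu' fun ψ hψ hc hs => ?_
  · filter_upwards [key] with r hr h0
    exact sub_eq_zero.1 (hr h0)
  set I : ℝ := ∫ r, ψ r with hI
  -- Subtracting I ψ₀ makes the integral vanish, so the primitive of η is again compactly supported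
  -- in (0, ∞) and is an admissible test function.
  set η : ℝ → ℝ := fun r => ψ r - I * ψ₀ r with hη
  have dη : ContDiff ℝ (⊤ : ℕ∞) η := hψ.sub (contDiff_const.mul d₀)
  obtain ⟨a, b, ha, hab, hK⟩ := exists_Icc_of_isCompact_subset_Ioi (hc.isCompact.union c₀.isCompact)
    (union_subset hs s₀)
  have η0 : ∀ r, r ∉ Icc a b → η r = 0 := by
    intro r hr
    have h1 : ψ r = 0 := image_eq_zero_of_notMem_tsupport fun h => hr (hK (Or.inl h))
    have h2 : ψ₀ r = 0 := image_eq_zero_of_notMem_tsupport fun h => hr (hK (Or.inr h))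
    simp [hη, h1, h2]
  have ηI : ∫ r, η r = 0 := by
    rw [hη, integral_sub (hψ.continuous.integrable_of_hasCompactSupport hc)
      ((d₀.continuous.integrable_of_hasCompactSupport c₀).const_mul I), integral_const_mul, i₀]
    simp [hI]
  set ζ : ℝ → ℝ := fun r => ∫ t in (0 : ℝ)..r, η t with hζ
  have ζd : ∀ r, HasDerivAt ζ (η r) r := fun r =>
    intervalIntegral.integral_hasDerivAt_right (dη.continuous.intervalIntegrable _ _)
      (dη.continuous.stronglyMeasurableAtFilter _ _) dη.continuous.continuousAt
  have ζ' : deriv ζ = η := funext fun r => (ζd r).deriv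
  have ζc : ContDiff ℝ (⊤ : ℕ∞) ζ :=
    contDiff_infty_iff_deriv.2 ⟨fun r => (ζd r).differentiableAt, by rwa [ζ']⟩
  have ζ0 : ∀ r, r ∉ Icc a b → ζ r = 0 := by
    intro r hr
    rcases lt_or_ge r a with h1 | h1
    · refine intervalIntegral.integral_zero_ae (Eventually.of_forall fun t ht => η0 t fun hm => ?_)
      have := ht.2
      rcases le_max_iff.1 this with h | h <;> linarith [hm.1]
    · have h2 : b < r := lt_of_not_ge fun h2 => hr ⟨h1, h2⟩
      have e : ζ r = ∫ t in Ioc 0 r, η t :=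
        intervalIntegral.integral_of_le (by linarith)
      rw [e, setIntegral_eq_integral_of_forall_compl_eq_zero, ηI]
      intro t ht
      refine η0 t fun hm => ht ⟨by linarith [hm.1], by linarith [hm.2]⟩
  have ζt : tsupport ζ ⊆ Icc a b :=
    closure_minimal (fun r hr => by_contra fun h' => hr (ζ0 r h')) isClosed_Icc
  have ζcs : HasCompactSupport ζ := isCompact_Icc.of_isClosed_subset (isClosed_tsupport _) ζt
  have := h ζ ζc ζcs (ζt.trans fun r hr => ha.trans_le hr.1)
  rw [ζ'] at this
  have j1 := integrable_smul_of_locallyIntegrableOn hu hψ.continuous hc hs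
  have j2 := integrable_smul_of_locallyIntegrableOn hu d₀.continuous c₀ s₀
  have e1 : ∫ r, η r • u r = (∫ r, ψ r • u r) - I • ∫ r, ψ₀ r • u r := by
    have j3 : Integrable fun r => I • ψ₀ r • u r := j2.smul I
    rw [← integral_smul, ← integral_sub j1 j3]
    simp only [hη, sub_smul, mul_smul]
  have e2 : ∫ r, ψ r • (u r - ∫ r, ψ₀ r • u r) = (∫ r, ψ r • u r) - I • ∫ r, ψ₀ r • u r := by
    simp only [smul_sub]
    rw [integral_sub j1 ((hψ.continuous.integrable_of_hasCompactSupport hc).smul_const _),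
      integral_smul_const]
  rw [e2, ← e1, this]

theorem integrable_smul_of_memLp {d : ℕ} {F : Type*} [NormedAddCommGroup F] [NormedSpace ℝ F]
    {f : Space d → F} (hf : MemLp f 2 volume) {φ : Space d → ℝ} (hφ : Continuous φ)
    (hc : HasCompactSupport φ) : Integrable fun x => φ x • f x :=
  (hf.locallyIntegrable one_le_two).integrable_smul_left_of_hasCompactSupport hφ hc

/-- The weak gradient tested against the radial vector field `ζ(|x|) |x|^{-d} x`. -/
theorem IsWeakGradient.integral_radial_field {d : ℕ} {f : Space d → ℂ}
    {G : Space d → EuclideanSpace ℂ (Fin d)} (h : IsWeakGradient f G) (hf : MemLp f 2 volume)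
    (hG : MemLp G 2 volume) (hd : 3 ≤ d) {ζ : ℝ → ℝ} (hζ : ContDiff ℝ (⊤ : ℕ∞) ζ)
    (hc : HasCompactSupport ζ) (h0 : tsupport ζ ⊆ Ioi 0) :
    ∫ x, (deriv ζ ‖x‖ * ‖x‖ * (‖x‖ ^ d)⁻¹) • f x =
      -∫ x, (ζ ‖x‖ * (‖x‖ ^ d)⁻¹) • ∑ i, x i • G x i := by
  have := nontrivial_space hd
  set ξ : ℝ → ℝ := fun r => ζ r * (r ^ d)⁻¹ with hξ
  set U : Space d → ℝ := fun x => ξ ‖x‖ with hU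
  have hUc : ContDiff ℝ (⊤ : ℕ∞) U := by
    rw [contDiff_iff_contDiffAt]
    intro x
    by_cases hx : ‖x‖ ∈ tsupport ζ
    · have hx0 : 0 < ‖x‖ := h0 hx
      have hx1 : ContDiffAt ℝ (⊤ : ℕ∞) (fun x : Space d => ‖x‖) x :=
        contDiffAt_norm ℝ (norm_pos_iff.1 hx0)
      exact (hζ.contDiffAt.comp x hx1).mul ((hx1.pow d).inv (pow_pos hx0 d).ne')
    -- The origin falls in this case: U vanishes near it, so the singularities of the norm and of
    -- the inverse power are harmless.
    · have : U =ᶠ[𝓝 x] fun _ => 0 := by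
        have : ∀ᶠ y in 𝓝 x, ‖y‖ ∈ (tsupport ζ)ᶜ :=
          continuous_norm.continuousAt.eventually_mem ((isClosed_tsupport ζ).isOpen_compl.mem_nhds hx)
        filter_upwards [this] with y hy
        simp [hU, hξ, image_eq_zero_of_notMem_tsupport hy]
      exact contDiffAt_const.congr_of_eventuallyEq this
  have hUs : HasCompactSupport U := by
    obtain ⟨a, b, ha, hab, hK⟩ := exists_Icc_of_isCompact_subset_Ioi hc.isCompact h0
    refine HasCompactSupport.intro (isCompact_closedBall (0 : Space d) b) fun x hx => ?_
    have : ζ ‖x‖ = 0 := image_eq_zero_of_notMem_tsupport fun hm => hx (by simpa using (hK hm).2)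
    simp [hU, hξ, this]
  set φ : Fin d → Space d → ℝ := fun i x => U x * x i with hφ
  have hcoord : ∀ i : Fin d, ContDiff ℝ (⊤ : ℕ∞) fun x : Space d => x i := fun i =>
    (EuclideanSpace.proj (𝕜 := ℝ) i).contDiff
  have hφc : ∀ i, ContDiff ℝ (⊤ : ℕ∞) (φ i) := fun i => hUc.mul (hcoord i)
  have hφs : ∀ i, HasCompactSupport (φ i) := fun i => hUs.mul_right
  have hsum := Finset.sum_congr rfl fun i (_ : i ∈ (Finset.univ : Finset (Fin d))) =>
    h (φ i) (hφc i) (hφs i) i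
  have hGi : ∀ i, MemLp (fun x => G x i) 2 volume := fun i =>
    hG.of_le ((EuclideanSpace.proj (𝕜 := ℂ) i).continuous.comp_aestronglyMeasurable hG.1)
      (Eventually.of_forall fun x => PiLp.norm_apply_le (G x) i)
  have hd1 : ∀ i, Continuous fun x => fderiv ℝ (φ i) x (EuclideanSpace.single i 1) := fun i =>
    ((hφc i).continuous_fderiv (by simp)).clm_apply continuous_const
  have hd2 : ∀ i, HasCompactSupport fun x => fderiv ℝ (φ i) x (EuclideanSpace.single i 1) :=
    fun i => (hφs i).fderiv_apply (𝕜 := ℝ) _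
  rw [← integral_finsetSum _ fun i _ => integrable_smul_of_memLp hf (hd1 i) (hd2 i),
    Finset.sum_neg_distrib, ← integral_finsetSum _ fun i _ =>
      integrable_smul_of_memLp (hGi i) (hφc i).continuous (hφs i)] at hsum
  have hdiv : ∀ x : Space d, x ≠ 0 →
      ∑ i, fderiv ℝ (φ i) x (EuclideanSpace.single i 1) = deriv ζ ‖x‖ * ‖x‖ * (‖x‖ ^ d)⁻¹ := by
    intro x hx
    have hx0 : 0 < ‖x‖ := norm_pos_iff.2 hx
    have hUd : DifferentiableAt ℝ U x := hUc.differentiable (by simp) x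
    have e1 : ∀ i, fderiv ℝ (φ i) x (EuclideanSpace.single i 1) =
        fderiv ℝ U x (x i • EuclideanSpace.single i 1) + U x := by
      intro i
      have h1 : HasFDerivAt (fun x : Space d => x i) (EuclideanSpace.proj (𝕜 := ℝ) i) x :=
        (EuclideanSpace.proj (𝕜 := ℝ) i).hasFDerivAt
      have h2 := (hUd.hasFDerivAt.mul h1).fderiv
      have h3 : fderiv ℝ (φ i) x = U x • EuclideanSpace.proj (𝕜 := ℝ) i + x i • fderiv ℝ U x := h2
      rw [h3]
      simp
      ring
    have e2 : ∑ i, x i • EuclideanSpace.single i (1 : ℝ) = x := by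
      ext j
      simp [Finset.sum_apply, Pi.single_apply]
    -- The radial derivative is computed along the ray t ↦ t x at t = 1.
    have e3 : fderiv ℝ U x x = (deriv ζ ‖x‖ * (‖x‖ ^ d)⁻¹ +
        ζ ‖x‖ * (-(d * ‖x‖ ^ (d - 1)) / (‖x‖ ^ d) ^ 2)) * ‖x‖ := by
      have h1 : HasDerivAt (fun t : ℝ => t • x) x 1 := by
        simpa using (hasDerivAt_id (1 : ℝ)).smul_const x
      have h2 : HasDerivAt (fun t : ℝ => U (t • x)) (fderiv ℝ U x x) 1 := by
        have : HasFDerivAt U (fderiv ℝ U x) ((1 : ℝ) • x) := by simpa using hUd.hasFDerivAt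
        exact this.comp_hasDerivAt 1 h1
      have h3 : HasDerivAt ξ (deriv ζ ‖x‖ * (‖x‖ ^ d)⁻¹ +
          ζ ‖x‖ * (-(d * ‖x‖ ^ (d - 1)) / (‖x‖ ^ d) ^ 2)) (1 * ‖x‖) := by
        rw [one_mul]
        exact (hζ.differentiable (by simp) ‖x‖).hasDerivAt.mul
          ((hasDerivAt_pow d ‖x‖).fun_inv (pow_pos hx0 d).ne')
      have h4 : HasDerivAt (fun t : ℝ => t * ‖x‖) ‖x‖ 1 := by
        simpa using (hasDerivAt_id (1 : ℝ)).mul_const ‖x‖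
      have h5 := HasDerivAt.comp (h₂ := ξ) (1 : ℝ) h3 h4
      refine h2.unique (h5.congr_of_eventuallyEq ?_)
      filter_upwards [lt_mem_nhds (show (0 : ℝ) < 1 from one_pos)] with t ht
      simp [hU, norm_smul, abs_of_pos ht]
    simp only [e1]
    rw [Finset.sum_add_distrib, ← map_sum, e2, e3]
    simp only [hU, hξ, Finset.sum_const, Finset.card_univ, Fintype.card_fin, nsmul_eq_mul]
    have hp : ‖x‖ ^ (d - 1) * ‖x‖ = ‖x‖ ^ d := by
      rw [← pow_succ]; congr 1; omega
    have hpd : ‖x‖ ^ d ≠ 0 := (pow_pos hx0 d).ne'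
    rw [add_mul, show ζ ‖x‖ * (-(d * ‖x‖ ^ (d - 1)) / (‖x‖ ^ d) ^ 2) * ‖x‖
      = -(d * ζ ‖x‖ * (‖x‖ ^ (d - 1) * ‖x‖)) / (‖x‖ ^ d) ^ 2 by ring, hp]
    field_simp
    ring
  have hae : ∀ᵐ x : Space d, x ≠ 0 := by
    simp [ae_iff]
  calc ∫ x, (deriv ζ ‖x‖ * ‖x‖ * (‖x‖ ^ d)⁻¹) • f x
      = ∫ x, ∑ i, fderiv ℝ (φ i) x (EuclideanSpace.single i 1) • f x := by
        refine integral_congr_ae ?_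
        filter_upwards [hae] with x hx
        rw [← Finset.sum_smul, hdiv x hx]
    _ = _ := by
        rw [hsum]
        simp only [hφ, hU, hξ, mul_smul, Finset.smul_sum]


/-! ### Representation kernel and radial decay -/

/-- The inclusion `ℝ^d ⊆ ℂ^d`. -/
noncomputable def complexify {d : ℕ} (x : Space d) : EuclideanSpace ℂ (Fin d) :=
  WithLp.toLp 2 fun i => (x i : ℂ)

theorem norm_complexify {d : ℕ} (x : Space d) : ‖complexify x‖ = ‖x‖ := by
  simp [complexify, EuclideanSpace.norm_eq]

theorem continuous_complexify {d : ℕ} : Continuous (complexify (d := d)) := by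
  unfold complexify
  fun_prop

/-- The kernel `1_{|y| > r} |y|^{-d} y`, which represents point evaluation of radial functions. -/
noncomputable def radialKernel {d : ℕ} (r : ℝ) (y : Space d) : EuclideanSpace ℂ (Fin d) :=
  (Ioi r).indicator (fun s : ℝ => (s ^ d)⁻¹) ‖y‖ • complexify y

/-- The field `|y|^{-d} y · G(y)`. -/
noncomputable def radialField {d : ℕ} (G : Space d → EuclideanSpace ℂ (Fin d)) (y : Space d) : ℂ :=
  (‖y‖ ^ d)⁻¹ • ∑ i, y i • G y i

/-- The radial profile with gradient `G` that vanishes at infinity. -/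
noncomputable def profile {d : ℕ} (G : Space d → EuclideanSpace ℂ (Fin d)) (r : ℝ) : ℂ :=
  -(sphereArea d)⁻¹ • ∫ y, inner ℂ (radialKernel r y) (G y)

theorem inner_complexify {d : ℕ} (y : Space d) (v : EuclideanSpace ℂ (Fin d)) :
    inner ℂ (complexify y) v = ∑ i, y i • v i := by
  rw [PiLp.inner_apply]
  refine Finset.sum_congr rfl fun i _ => ?_
  simp [complexify, mul_comm]

theorem inner_radialKernel {d : ℕ} (G : Space d → EuclideanSpace ℂ (Fin d)) (r : ℝ)
    (y : Space d) :
    inner ℂ (radialKernel r y) (G y) = (Ioi r).indicator (fun _ => radialField G y) ‖y‖ := by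
  rw [radialKernel, inner_smul_left_eq_smul, inner_complexify, radialField]
  by_cases h : ‖y‖ ∈ Ioi r
  · rw [indicator_of_mem h, indicator_of_mem h]
  · rw [indicator_of_notMem h, indicator_of_notMem h]
    simp

theorem inv_pow_mul_self_eq_rpow {d : ℕ} (hd : 3 ≤ d) {r : ℝ} (hr : 0 ≤ r) :
    (r ^ d)⁻¹ * r = r ^ (1 - d : ℝ) := by
  rcases hr.eq_or_lt with rfl | hr
  · have : (1 - d : ℝ) ≠ 0 := by
      have : (3 : ℝ) ≤ d := by exact_mod_cast hd
      linarith
    simp [Real.zero_rpow this]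
  · rw [sub_eq_neg_add, Real.rpow_add hr, Real.rpow_neg hr.le, Real.rpow_natCast, Real.rpow_one]

theorem norm_radialKernel {d : ℕ} (hd : 3 ≤ d) {r : ℝ} (y : Space d) :
    ‖radialKernel r y‖ = (Ioi r).indicator (fun s : ℝ => s ^ (1 - d : ℝ)) ‖y‖ := by
  rw [radialKernel, norm_smul, norm_complexify]
  by_cases h : ‖y‖ ∈ Ioi r
  · rw [indicator_of_mem h, indicator_of_mem h, Real.norm_of_nonneg (by positivity),
      inv_pow_mul_self_eq_rpow hd (norm_nonneg y)]
  · simp [indicator_of_notMem h]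

theorem norm_radialField_le {d : ℕ} (hd : 3 ≤ d) (G : Space d → EuclideanSpace ℂ (Fin d))
    (y : Space d) : ‖radialField G y‖ ≤ ‖y‖ ^ (1 - d : ℝ) * ‖G y‖ := by
  rw [radialField, norm_smul, Real.norm_of_nonneg (by positivity), ← inner_complexify,
    ← inv_pow_mul_self_eq_rpow hd (norm_nonneg y), mul_assoc]
  gcongr
  exact (norm_inner_le_norm _ _).trans_eq (by rw [norm_complexify])

theorem measurable_radialKernel {d : ℕ} (r : ℝ) :
    Measurable (radialKernel (d := d) r) := by
  have h1 : Measurable ((Ioi r).indicator fun s : ℝ => (s ^ d)⁻¹) :=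
    (by fun_prop : Measurable fun s : ℝ => (s ^ d)⁻¹).indicator measurableSet_Ioi
  exact (h1.comp measurable_norm).smul continuous_complexify.measurable

theorem aestronglyMeasurable_radialField {d : ℕ} {G : Space d → EuclideanSpace ℂ (Fin d)}
    (hG : AEStronglyMeasurable G volume) : AEStronglyMeasurable (radialField G) volume := by
  have h : radialField G = fun y => (‖y‖ ^ d)⁻¹ • inner ℂ (complexify y) (G y) := by
    ext y
    rw [radialField, inner_complexify]
  rw [h]
  have h1 : Measurable fun y : Space d => (‖y‖ ^ d)⁻¹ := by fun_prop
  exact h1.aestronglyMeasurable.smul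
    (continuous_complexify.aestronglyMeasurable.inner hG)

theorem measurable_indicator_rpow_norm {d : ℕ} (r q : ℝ) :
    Measurable fun y : Space d => (Ioi r).indicator (fun s : ℝ => s ^ q) ‖y‖ :=
  ((by fun_prop : Measurable fun s : ℝ => s ^ q).indicator measurableSet_Ioi).comp measurable_norm

theorem indicator_rpow_nonneg {d : ℕ} (r q : ℝ) (y : Space d) :
    0 ≤ (Ioi r).indicator (fun s : ℝ => s ^ q) ‖y‖ := by
  by_cases h : ‖y‖ ∈ Ioi r
  · rw [indicator_of_mem h]; positivity
  · rw [indicator_of_notMem h]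

theorem indicator_rpow_sq {d : ℕ} {r : ℝ} (hr : 0 < r) (q : ℝ) (y : Space d) :
    ((Ioi r).indicator (fun s : ℝ => s ^ q) ‖y‖) ^ 2 =
      (Ioi r).indicator (fun s : ℝ => s ^ (2 * q)) ‖y‖ := by
  by_cases h : ‖y‖ ∈ Ioi r
  · have : 0 < ‖y‖ := hr.trans h
    rw [indicator_of_mem h, indicator_of_mem h, two_mul, Real.rpow_add this, sq]
  · simp [indicator_of_notMem h]

theorem memLp_indicator_rpow {d : ℕ} (hd : 3 ≤ d) {q r : ℝ} (hq : (d : ℝ) + 2 * q < 0)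
    (hr : 0 < r) :
    MemLp (fun y : Space d => (Ioi r).indicator (fun s : ℝ => s ^ q) ‖y‖) 2 volume := by
  rw [memLp_two_iff_integrable_sq (measurable_indicator_rpow_norm r q).aestronglyMeasurable]
  simp only [indicator_rpow_sq hr]
  exact integrable_norm_rpow_outside hd hq hr

/-- The squared kernel is |y|^(2-2d) outside a ball, integrable since 2 - d < 0. Point evaluation
off the origin is thus a weakly continuous functional of the gradient. -/
theorem memLp_radialKernel {d : ℕ} (hd : 3 ≤ d) {r : ℝ} (hr : 0 < r) :
    MemLp (radialKernel (d := d) r) 2 volume := by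
  have h3 : (3 : ℝ) ≤ d := by exact_mod_cast hd
  refine (memLp_indicator_rpow hd (q := 1 - d) (by linarith) hr).mono
    (measurable_radialKernel r).aestronglyMeasurable (Eventually.of_forall fun y => ?_)
  rw [norm_radialKernel hd]
  exact le_abs_self _

theorem memLp_indicator_rpow_mul {d : ℕ} {G : Space d → EuclideanSpace ℂ (Fin d)}
    (hG : MemLp G 2 volume) {q r : ℝ} (hq : q ≤ 0) (hr : 0 < r) :
    MemLp (fun y : Space d => (Ioi r).indicator (fun s : ℝ => s ^ q) ‖y‖ * ‖G y‖) 2 volume := by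
  refine hG.norm.of_le_mul (c := r ^ q)
    ((measurable_indicator_rpow_norm r q).aestronglyMeasurable.mul hG.1.norm)
    (Eventually.of_forall fun y => ?_)
  rw [norm_mul, Real.norm_of_nonneg (indicator_rpow_nonneg r q y)]
  gcongr
  by_cases h : ‖y‖ ∈ Ioi r
  · rw [indicator_of_mem h]
    exact Real.rpow_le_rpow_of_nonpos hr (le_of_lt h) hq
  · rw [indicator_of_notMem h]; positivity

theorem rpow_split_indicator {d : ℕ} {r : ℝ} (hr : 0 < r) (q a : ℝ) (y : Space d) :
    (Ioi r).indicator (fun s : ℝ => s ^ q) ‖y‖ = (Ioi r).indicator (fun s : ℝ => s ^ (q - a)) ‖y‖ *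
      (Ioi r).indicator (fun s : ℝ => s ^ a) ‖y‖ := by
  by_cases h : ‖y‖ ∈ Ioi r
  · have : 0 < ‖y‖ := hr.trans h
    simp only [indicator_of_mem h]
    rw [← Real.rpow_add this, sub_add_cancel]
  · simp [indicator_of_notMem h]

theorem integrable_indicator_rpow_mul_norm {d : ℕ} (hd : 3 ≤ d)
    {G : Space d → EuclideanSpace ℂ (Fin d)} (hG : MemLp G 2 volume) {r : ℝ} (hr : 0 < r) :
    Integrable fun y : Space d => (Ioi r).indicator (fun s : ℝ => s ^ (1 - d : ℝ)) ‖y‖ * ‖G y‖ := by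
  have h3 : (3 : ℝ) ≤ d := by exact_mod_cast hd
  exact (memLp_indicator_rpow hd (q := 1 - d) (by linarith) hr).integrable_mul hG.norm

/-- A weighted Cauchy-Schwarz bound for `∫_{|y| > r} |y|^{1-d} |G|`. -/
theorem sq_integral_indicator_rpow_le {d : ℕ} (hd : 3 ≤ d)
    {G : Space d → EuclideanSpace ℂ (Fin d)} (hG : MemLp G 2 volume) {a r : ℝ} (ha : a ≤ 0)
    (ha' : 2 - (d : ℝ) < a) (hr : 0 < r) :
    (∫ y : Space d, (Ioi r).indicator (fun s : ℝ => s ^ (1 - d : ℝ)) ‖y‖ * ‖G y‖) ^ 2 ≤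
      sphereArea d / (d - 2 + a) * r ^ (2 - d - a) *
        ∫ y : Space d, (Ioi r).indicator (fun s : ℝ => s ^ a) ‖y‖ * ‖G y‖ ^ 2 := by
  -- Split |y|^(1-d) as |y|^(1-d-a/2) |y|^(a/2). The first factor is square integrable at infinity
  -- exactly when a > 2 - d.
  set F₁ : Space d → ℝ := fun y => (Ioi r).indicator (fun s : ℝ => s ^ (1 - d - a / 2)) ‖y‖ with h₁
  set F₂ : Space d → ℝ := fun y => (Ioi r).indicator (fun s : ℝ => s ^ (a / 2)) ‖y‖ * ‖G y‖ with h₂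
  have m₁ : MemLp F₁ 2 volume := memLp_indicator_rpow hd (by linarith) hr
  have m₂ : MemLp F₂ 2 volume := memLp_indicator_rpow_mul hG (by linarith) hr
  have e : ∀ y : Space d, (Ioi r).indicator (fun s : ℝ => s ^ (1 - d : ℝ)) ‖y‖ * ‖G y‖
      = F₁ y * F₂ y := by
    intro y
    rw [rpow_split_indicator hr _ (a / 2), mul_assoc]
  have n₁ : ∀ y, 0 ≤ F₁ y := fun y => indicator_rpow_nonneg _ _ y
  have n₂ : ∀ y, 0 ≤ F₂ y := fun y => mul_nonneg (indicator_rpow_nonneg _ _ y) (norm_nonneg _)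
  have key := integral_mul_le_Lp_mul_Lq_of_nonneg (μ := (volume : Measure (Space d)))
    Real.HolderConjugate.two_two (Eventually.of_forall n₁) (Eventually.of_forall n₂)
    (by simpa using m₁) (by simpa using m₂)
  simp only [Real.rpow_two] at key
  rw [← Real.sqrt_eq_rpow, ← Real.sqrt_eq_rpow, ← Real.sqrt_mul
    (integral_nonneg fun _ => sq_nonneg _)] at key
  simp only [e]
  have k0 : 0 ≤ ∫ y, F₁ y * F₂ y := integral_nonneg fun y => mul_nonneg (n₁ y) (n₂ y)
  have k1 : 0 ≤ (∫ y, F₁ y ^ 2) * ∫ y, F₂ y ^ 2 :=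
    mul_nonneg (integral_nonneg fun _ => sq_nonneg _) (integral_nonneg fun _ => sq_nonneg _)
  have := (Real.le_sqrt k0 k1).1 key
  refine this.trans_eq ?_
  congr 1
  · simp only [h₁, indicator_rpow_sq hr]
    rw [integral_norm_rpow_outside hd (by linarith) hr]
    congr 2 <;> ring
  · simp only [h₂, mul_pow, indicator_rpow_sq hr]
    congr 4
    ext y
    congr 3
    ext s
    congr 1
    ring

theorem norm_profile_le_integral {d : ℕ} (hd : 3 ≤ d)
    {G : Space d → EuclideanSpace ℂ (Fin d)} (hG : MemLp G 2 volume) {r : ℝ} (hr : 0 < r) :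
    ‖profile G r‖ ≤ (sphereArea d)⁻¹ *
      ∫ y : Space d, (Ioi r).indicator (fun s : ℝ => s ^ (1 - d : ℝ)) ‖y‖ * ‖G y‖ := by
  rw [profile, norm_smul, norm_neg, Real.norm_of_nonneg (inv_nonneg.2 (sphereArea_pos hd).le)]
  refine mul_le_mul_of_nonneg_left ?_ (inv_nonneg.2 (sphereArea_pos hd).le)
  refine norm_integral_le_of_norm_le (integrable_indicator_rpow_mul_norm hd hG hr)
    (Eventually.of_forall fun y => ?_)
  rw [← norm_radialKernel hd]
  exact norm_inner_le_norm _ _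

/-- The weight a stays free because it is used twice: a = 0 gives the pointwise decay and a = -1/2
gives Hardy's inequality. -/
theorem sq_norm_profile_le {d : ℕ} (hd : 3 ≤ d)
    {G : Space d → EuclideanSpace ℂ (Fin d)} (hG : MemLp G 2 volume) {a r : ℝ} (ha : a ≤ 0)
    (ha' : 2 - (d : ℝ) < a) (hr : 0 < r) :
    ‖profile G r‖ ^ 2 ≤ (sphereArea d * (d - 2 + a))⁻¹ * r ^ (2 - d - a) *
        ∫ y : Space d, (Ioi r).indicator (fun s : ℝ => s ^ a) ‖y‖ * ‖G y‖ ^ 2 := by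
  have h1 := pow_le_pow_left₀ (norm_nonneg _) (norm_profile_le_integral hd hG hr) 2
  rw [mul_pow] at h1
  have hσ := sphereArea_pos hd
  refine h1.trans ((mul_le_mul_of_nonneg_left (sq_integral_indicator_rpow_le hd hG ha ha' hr)
    (sq_nonneg _)).trans_eq ?_)
  have : (d : ℝ) - 2 + a ≠ 0 := by linarith
  field_simp

/-- The radial decay estimate. -/
theorem norm_profile_le {d : ℕ} (hd : 3 ≤ d)
    {G : Space d → EuclideanSpace ℂ (Fin d)} (hG : MemLp G 2 volume) {r : ℝ} (hr : 0 < r) :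
    ‖profile G r‖ ≤ √((sphereArea d * (d - 2))⁻¹ * ∫ y, ‖G y‖ ^ 2) *
      r ^ (-(((d : ℝ) - 2) / 2)) := by
  have h3 : (3 : ℝ) ≤ d := by exact_mod_cast hd
  have hσ := sphereArea_pos hd
  have h1 := sq_norm_profile_le hd hG (a := 0) le_rfl (by linarith) hr
  have h2 : ∫ y : Space d, (Ioi r).indicator (fun s : ℝ => s ^ (0 : ℝ)) ‖y‖ * ‖G y‖ ^ 2
      ≤ ∫ y, ‖G y‖ ^ 2 := by
    refine integral_mono_of_nonneg (Eventually.of_forall fun y =>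
      mul_nonneg (indicator_rpow_nonneg _ _ _) (sq_nonneg _))
      ((memLp_two_iff_integrable_sq_norm hG.1).1 hG) (Eventually.of_forall fun y => ?_)
    by_cases h : ‖y‖ ∈ Ioi r
    · simp [indicator_of_mem h]
    · simp only [indicator_of_notMem h, zero_mul]; positivity
  have hnn : 0 ≤ (sphereArea d * (d - 2 : ℝ))⁻¹ := by
    apply inv_nonneg.2
    exact mul_nonneg hσ.le (by linarith)
  refine abs_le_of_sq_le_sq' ?_ (by positivity) |>.2
  rw [mul_pow, Real.sq_sqrt (mul_nonneg hnn (integral_nonneg fun _ => sq_nonneg _)),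
    ← Real.rpow_natCast (r ^ _), ← Real.rpow_mul hr.le]
  have e : -(((d : ℝ) - 2) / 2) * ((2 : ℕ) : ℝ) = 2 - d - 0 := by push_cast; ring
  rw [e]
  rw [add_zero] at h1
  refine h1.trans ?_
  rw [mul_right_comm]
  gcongr


/-! ### Radial functions are recovered from their gradients -/

theorem aestronglyMeasurable_indicator_radialField {d : ℕ}
    {G : Space d → EuclideanSpace ℂ (Fin d)} (hG : AEStronglyMeasurable G volume) :
    AEStronglyMeasurable
      (fun z : ℝ × Space d => (Ioi z.1).indicator (fun _ => radialField G z.2) ‖z.2‖)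
      (volume.prod volume) := by
  have hs : MeasurableSet {z : ℝ × Space d | z.1 < ‖z.2‖} :=
    measurableSet_lt measurable_fst (measurable_norm.comp measurable_snd)
  have h := ((aestronglyMeasurable_radialField hG).comp_snd
    (μ := (volume : Measure ℝ))).indicator hs
  refine h.congr (Eventually.of_forall fun z => ?_)
  by_cases hz : z.1 < ‖z.2‖
  · rw [indicator_of_mem (show z ∈ {z : ℝ × Space d | z.1 < ‖z.2‖} from hz)]
    simp [hz]
  · rw [indicator_of_notMem (show z ∉ {z : ℝ × Space d | z.1 < ‖z.2‖} from hz)]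
    simp [hz]

theorem aestronglyMeasurable_profile {d : ℕ} {G : Space d → EuclideanSpace ℂ (Fin d)}
    (hG : AEStronglyMeasurable G volume) : AEStronglyMeasurable (profile G) volume := by
  unfold profile
  simp only [inner_radialKernel]
  exact AEStronglyMeasurable.const_smul
    (aestronglyMeasurable_indicator_radialField hG).integral_prod_right' (-(sphereArea d)⁻¹ : ℝ)

theorem locallyIntegrableOn_profile {d : ℕ} (hd : 3 ≤ d) {G : Space d → EuclideanSpace ℂ (Fin d)}
    (hG : MemLp G 2 volume) : LocallyIntegrableOn (profile G) (Ioi 0) := by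
  have h3 : (3 : ℝ) ≤ d := by exact_mod_cast hd
  rw [locallyIntegrableOn_iff isOpen_Ioi.isLocallyClosed]
  intro K hK hKc
  obtain ⟨a, b, ha, -, hab⟩ := exists_Icc_of_isCompact_subset_Ioi hKc hK
  refine Measure.integrableOn_of_bounded
    (M := √((sphereArea d * (d - 2))⁻¹ * ∫ y, ‖G y‖ ^ 2) * a ^ (-(((d : ℝ) - 2) / 2)))
    hKc.measure_lt_top.ne (aestronglyMeasurable_profile hG.1) ?_
  filter_upwards [ae_restrict_mem hKc.measurableSet] with r hr
  have har := (hab hr).1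
  refine (norm_profile_le hd hG (ha.trans_le har)).trans ?_
  exact mul_le_mul_of_nonneg_left (Real.rpow_le_rpow_of_nonpos ha har (by linarith))
    (Real.sqrt_nonneg _)

/-- On a shell a ≤ |x| ≤ b the Jacobian r^(d-1) is bounded away from zero and can be divided out. -/
theorem locallyIntegrableOn_of_radial {d : ℕ} (hd : 3 ≤ d) {f : Space d → ℂ}
    (hf : MemLp f 2 volume) {g : ℝ → ℂ} (hfg : f =ᵐ[volume] fun x => g ‖x‖) :
    LocallyIntegrableOn g (Ioi 0) := by
  rw [locallyIntegrableOn_iff isOpen_Ioi.isLocallyClosed]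
  intro K hK hKc
  obtain ⟨a, b, ha, -, hab⟩ := exists_Icc_of_isCompact_subset_Ioi hKc hK
  refine IntegrableOn.mono_set ?_ hab
  have h1 : IntegrableOn (fun x : Space d => g ‖x‖) (Metric.closedBall 0 b) :=
    ((hf.locallyIntegrable one_le_two).integrableOn_isCompact (isCompact_closedBall 0 b)).congr
      (ae_restrict_of_ae hfg)
  rw [← integrable_indicator_iff measurableSet_closedBall] at h1
  have h2 : Integrable fun x : Space d => (Iic b).indicator g ‖x‖ := by
    refine h1.congr (Eventually.of_forall fun x => ?_)
    by_cases hx : ‖x‖ ≤ b <;> simp [indicator, hx]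
  have h3 := ((integrable_radial hd).1 h2).mono_set (s := Icc a b)
    fun r hr => mem_Ioi.2 (ha.trans_le hr.1)
  have hc : ContinuousOn (fun r : ℝ => (r ^ (d - 1))⁻¹) (Icc a b) :=
    ContinuousOn.inv₀ (by fun_prop) fun r hr => (pow_pos (ha.trans_le hr.1) _).ne'
  refine (h3.continuousOn_smul hc isCompact_Icc).congr_fun (fun r hr => ?_) measurableSet_Icc
  have h0 : r ^ (d - 1) ≠ 0 := (pow_pos (ha.trans_le hr.1) _).ne'
  have : r ∈ Iic b := hr.2
  simp only [indicator_of_mem this, smul_smul, inv_mul_cancel₀ h0, one_smul]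

/-- Fubini: for fixed y, integrating ζ' over r < |y| leaves ζ(|y|). -/
theorem integral_deriv_smul_profile {d : ℕ} (hd : 3 ≤ d) {G : Space d → EuclideanSpace ℂ (Fin d)}
    (hG : MemLp G 2 volume) {ζ : ℝ → ℝ} (hζ : ContDiff ℝ (⊤ : ℕ∞) ζ) (hc : HasCompactSupport ζ)
    (h0 : tsupport ζ ⊆ Ioi 0) :
    ∫ r, deriv ζ r • profile G r = -(sphereArea d)⁻¹ • ∫ y, ζ ‖y‖ • radialField G y := by
  obtain ⟨a, b, ha, -, hab⟩ := exists_Icc_of_isCompact_subset_Ioi hc.isCompact h0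
  have hζ1 : ContDiff ℝ 1 ζ := hζ.of_le (by simp)
  have hdc : Continuous (deriv ζ) := hζ1.continuous_deriv le_rfl
  have hd0 : ∀ r, r < a → deriv ζ r = 0 := fun r hr =>
    image_eq_zero_of_notMem_tsupport fun h =>
      absurd (hab (closure_mono (support_deriv_subset) h |> fun h => by
        rwa [isClosed_tsupport ζ |>.closure_eq] at h)).1 (not_le.2 hr)
  have hdi : Integrable (deriv ζ) := hdc.integrable_of_hasCompactSupport hc.deriv
  have hint : Integrable (Function.uncurry fun (r : ℝ) (y : Space d) =>
      deriv ζ r • (Ioi r).indicator (fun _ => radialField G y) ‖y‖) (volume.prod volume) := by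
    -- Since ζ' vanishes below a, the cutoff |y| > r may be enlarged to |y| > a, which decouples the
    -- variables.
    have hb := hdi.norm.mul_prod (integrable_indicator_rpow_mul_norm hd hG ha)
    refine hb.mono' ((hdc.measurable.comp measurable_fst).aestronglyMeasurable.smul
      (aestronglyMeasurable_indicator_radialField hG.1)) (Eventually.of_forall fun z => ?_)
    obtain ⟨r, y⟩ := z
    simp only [Function.uncurry_apply_pair, norm_smul]
    by_cases hr : r < a
    · simp [hd0 r hr]
    · refine mul_le_mul_of_nonneg_left ?_ (norm_nonneg _)
      by_cases hy : ‖y‖ ∈ Ioi r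
      · rw [indicator_of_mem hy, indicator_of_mem (show ‖y‖ ∈ Ioi a from lt_of_le_of_lt (not_lt.1 hr) hy)]
        exact norm_radialField_le hd G y
      · rw [indicator_of_notMem hy, norm_zero]
        exact mul_nonneg (indicator_rpow_nonneg _ _ _) (norm_nonneg _)
  have e1 : ∀ r, deriv ζ r • profile G r = -(sphereArea d)⁻¹ • ∫ y,
      deriv ζ r • (Ioi r).indicator (fun _ => radialField G y) ‖y‖ := by
    intro r
    rw [profile, smul_comm, integral_smul]
    simp only [inner_radialKernel]
  simp only [e1]
  rw [integral_smul, integral_integral_swap hint]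
  congr 2
  ext y
  have e2 : ∀ r, deriv ζ r • (Ioi r).indicator (fun _ => radialField G y) ‖y‖ =
      (Iio ‖y‖).indicator (fun r => deriv ζ r • radialField G y) r := by
    intro r
    by_cases hy : r < ‖y‖
    · rw [indicator_of_mem (show ‖y‖ ∈ Ioi r from hy), indicator_of_mem (show r ∈ Iio ‖y‖ from hy)]
    · rw [indicator_of_notMem (show ‖y‖ ∉ Ioi r from hy),
        indicator_of_notMem (show r ∉ Iio ‖y‖ from hy), smul_zero]
  simp only [e2]
  rw [integral_indicator measurableSet_Iio, integral_smul_const, ← integral_Iic_eq_integral_Iio,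
    hc.integral_Iic_deriv_eq hζ1]

/-- If c ≠ 0, then |f| ≥ |c|/2 off a ball, a set of infinite measure, against Chebyshev's inequality
in L². -/
theorem eq_zero_of_memLp_of_tendsto_norm {d : ℕ} (hd : 3 ≤ d) {f : Space d → ℂ}
    (hf : MemLp f 2 volume) {c : ℂ} {h : ℝ → ℂ} (hh : Tendsto h atTop (𝓝 0))
    (hfh : ∀ᵐ x, f x = h ‖x‖ + c) : c = 0 := by
  have := nontrivial_space hd
  by_contra hc
  have hc' : 0 < ‖c‖ := norm_pos_iff.2 hc
  have hh' : ∀ᶠ r in atTop, ‖h r‖ < ‖c‖ / 2 :=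
    (tendsto_zero_iff_norm_tendsto_zero.1 hh).eventually (gt_mem_nhds (half_pos hc'))
  obtain ⟨R, hR⟩ := hh'.exists_forall_of_atTop
  have hε : (‖c‖ / 2).toNNReal ≠ 0 := (Real.toNNReal_pos.2 (half_pos hc')).ne'
  have hfin := hf.meas_ge_lt_top two_ne_zero ENNReal.ofNat_ne_top hε
  have hsub : (univ : Set (Space d)) ≤ᵐ[volume]
      (Metric.ball (0 : Space d) R ∪ {x | (‖c‖ / 2).toNNReal ≤ ‖f x‖₊} : Set (Space d)) := by
    filter_upwards [hfh] with x hx _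
    by_cases hxR : ‖x‖ < R
    · exact Or.inl (by simpa using hxR)
    · refine Or.inr ?_
      have h1 := hR ‖x‖ (not_lt.1 hxR)
      have h2 : ‖c‖ ≤ ‖f x‖ + ‖h ‖x‖‖ := by
        have : c = f x - h ‖x‖ := by rw [hx]; ring
        calc ‖c‖ = ‖f x - h ‖x‖‖ := by rw [← this]
          _ ≤ _ := norm_sub_le _ _
      change (‖c‖ / 2).toNNReal ≤ ‖f x‖₊
      rw [Real.toNNReal_le_iff_le_coe, coe_nnnorm]
      linarith
  have := measure_mono_ae hsub
  rw [measure_univ_of_isAddLeftInvariant] at this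
  exact absurd (lt_of_le_of_lt (this.trans (measure_union_le _ _))
    (ENNReal.add_lt_top.2 ⟨measure_ball_lt_top, hfin⟩)) (lt_irrefl _)

theorem tendsto_profile_atTop {d : ℕ} (hd : 3 ≤ d) {G : Space d → EuclideanSpace ℂ (Fin d)}
    (hG : MemLp G 2 volume) : Tendsto (profile G) atTop (𝓝 0) := by
  have h3 : (3 : ℝ) ≤ d := by exact_mod_cast hd
  rw [tendsto_zero_iff_norm_tendsto_zero]
  have h := (tendsto_rpow_neg_atTop (show 0 < ((d : ℝ) - 2) / 2 by linarith)).const_mul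
    (√((sphereArea d * (d - 2))⁻¹ * ∫ y, ‖G y‖ ^ 2))
  rw [mul_zero] at h
  refine tendsto_of_tendsto_of_tendsto_of_le_of_le' tendsto_const_nhds h
    (Eventually.of_forall fun _ => norm_nonneg _) ?_
  filter_upwards [eventually_gt_atTop 0] with r hr using norm_profile_le hd hG hr

/-- A radial function with gradient `G` is recovered from `G`. -/
theorem ae_eq_profile {d : ℕ} (hd : 3 ≤ d) {f : Space d → ℂ} (hf : MemLp f 2 volume)
    {G : Space d → EuclideanSpace ℂ (Fin d)} (hG : MemLp G 2 volume) (h : IsWeakGradient f G)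
    (hr : IsRadial f) : ∀ᵐ x, f x = profile G ‖x‖ := by
  obtain ⟨g, hg⟩ := hr
  have hσ := sphereArea_pos hd
  have hgl := locallyIntegrableOn_of_radial hd hf hg
  have hpl := locallyIntegrableOn_profile hd hG
  -- The given profile and the one built from G have the same distributional derivative on the half
  -- line, so they differ by a constant, which square integrability then kills.
  obtain ⟨c, hc⟩ := ae_eq_const_of_integral_deriv_smul_eq_zero (hgl.sub hpl)
    fun ζ hζ hζc hζ0 => by
    have hd1 : Continuous (deriv ζ) := (hζ.of_le (by simp : (1 : WithTop ℕ∞) ≤ _)).continuous_deriv le_rfl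
    have hts : tsupport (deriv ζ) ⊆ tsupport ζ :=
      closure_minimal support_deriv_subset (isClosed_tsupport ζ)
    have i1 := integrable_smul_of_locallyIntegrableOn hgl hd1 hζc.deriv (hts.trans hζ0)
    have i2 := integrable_smul_of_locallyIntegrableOn hpl hd1 hζc.deriv (hts.trans hζ0)
    simp only [Pi.sub_apply, smul_sub]
    rw [integral_sub i1 i2, sub_eq_zero, integral_deriv_smul_profile hd hG hζ hζc hζ0]
    have key := h.integral_radial_field hf hG hd hζ hζc hζ0
    have e1 : ∫ x, (deriv ζ ‖x‖ * ‖x‖ * (‖x‖ ^ d)⁻¹) • f x = sphereArea d • ∫ r, deriv ζ r • g r := by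
      have : ∫ x, (deriv ζ ‖x‖ * ‖x‖ * (‖x‖ ^ d)⁻¹) • f x =
          ∫ x : Space d, (fun r : ℝ => (deriv ζ r * r * (r ^ d)⁻¹) • g r) ‖x‖ := by
        refine integral_congr_ae ?_
        filter_upwards [hg] with x hx
        rw [hx]
      rw [this, integral_radial hd (fun r : ℝ => (deriv ζ r * r * (r ^ d)⁻¹) • g r),
        ← setIntegral_eq_integral_of_forall_compl_eq_zero (s := Ioi 0)
          (f := fun r => deriv ζ r • g r)]
      · congr 1
        refine setIntegral_congr_fun measurableSet_Ioi fun r hr => ?_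
        have hr' : (0 : ℝ) < r := hr
        simp only [smul_smul]
        congr 1
        have hp : r ^ d = r ^ (d - 1) * r := by rw [← pow_succ]; congr 1; omega
        have : r ^ (d - 1) ≠ 0 := (pow_pos hr' _).ne'
        rw [hp]
        field_simp
      · intro r hr
        rw [image_eq_zero_of_notMem_tsupport fun hm => hr (hζ0 (hts hm)), zero_smul]
    rw [e1] at key
    have e2 : ∫ x, (ζ ‖x‖ * (‖x‖ ^ d)⁻¹) • ∑ i, x i • G x i = ∫ y, ζ ‖y‖ • radialField G y := by
      simp only [radialField, mul_smul]
    rw [e2] at key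
    rw [neg_smul, ← smul_neg, ← key, smul_smul, inv_mul_cancel₀ hσ.ne', one_smul]
  have hx := ae_norm_of_ae_Ioi hd (p := fun r => (g - profile G) r = c)
    (by rw [ae_restrict_iff' measurableSet_Ioi]; exact hc)
  have hfc : ∀ᵐ x, f x = profile G ‖x‖ + c := by
    filter_upwards [hg, hx] with x h1 h2
    rw [h1, ← h2]
    simp
  have hc0 := eq_zero_of_memLp_of_tendsto_norm hd hf (tendsto_profile_atTop hd hG) hfc
  filter_upwards [hfc] with x hx
  rw [hx, hc0, add_zero]


/-! ### Weak limits in L² and Fatou's lemma -/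

theorem integral_inner_toLp {α F : Type*} [MeasurableSpace α] {μ : Measure α}
    [NormedAddCommGroup F] [InnerProductSpace ℂ F] {V G : α → F} (hV : MemLp V 2 μ)
    (hG : MemLp G 2 μ) : inner ℂ hV.toLp hG.toLp = ∫ x, inner ℂ (V x) (G x) ∂μ := by
  rw [L2.inner_def]
  refine integral_congr_ae ?_
  filter_upwards [hV.coeFn_toLp, hG.coeFn_toLp] with x h1 h2
  rw [h1, h2]

theorem sq_norm_toLp {α F : Type*} [MeasurableSpace α] {μ : Measure α}
    [NormedAddCommGroup F] [InnerProductSpace ℂ F] {G : α → F} (hG : MemLp G 2 μ) :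
    ‖hG.toLp‖ ^ 2 = ∫ x, ‖G x‖ ^ 2 ∂μ := by
  have h := inner_self_eq_norm_sq_to_K (𝕜 := ℂ) hG.toLp
  rw [integral_inner_toLp] at h
  simp only [inner_self_eq_norm_sq_to_K] at h
  have e : ∫ x, ((‖G x‖ : ℂ)) ^ 2 ∂μ = ((∫ x, ‖G x‖ ^ 2 ∂μ : ℝ) : ℂ) := by
    rw [← integral_complex_ofReal]
    push_cast
    rfl
  have h' : ((∫ x, ‖G x‖ ^ 2 ∂μ : ℝ) : ℂ) = ((‖hG.toLp‖ ^ 2 : ℝ) : ℂ) := by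
    rw [← e]; push_cast; exact h
  exact_mod_cast h'.symm

/-- Bounded sequences in a separable Hilbert space have weakly convergent subsequences. -/
theorem exists_weakly_convergent_subseq {H : Type*} [NormedAddCommGroup H]
    [InnerProductSpace ℂ H] [CompleteSpace H] [TopologicalSpace.SeparableSpace H] {u : ℕ → H}
    {C : ℝ} (hu : ∀ n, ‖u n‖ ≤ C) :
    ∃ (v : H) (φ : ℕ → ℕ), StrictMono φ ∧
      ∀ w, Tendsto (fun n => inner ℂ w (u (φ n))) atTop (𝓝 (inner ℂ w v)) := by
  obtain ⟨ℓ, -, φ, hφ, hl⟩ := WeakDual.isSeqCompact_closedBall ℂ H 0 C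
    (x := fun n => StrongDual.toWeakDual (InnerProductSpace.toDual ℂ H (u n)))
    (fun n => by simpa using hu n)
  refine ⟨(InnerProductSpace.toDual ℂ H).symm (WeakDual.toStrongDual ℓ), φ, hφ, fun w => ?_⟩
  have h1 := ((WeakDual.eval_continuous w).tendsto ℓ).comp hl
  have h2 := (Complex.continuous_conj.tendsto _).comp h1
  have e1 : ∀ n, inner ℂ w (u (φ n)) =
      (starRingEnd ℂ) (InnerProductSpace.toDual ℂ H (u (φ n)) w) := by
    intro n
    rw [InnerProductSpace.toDual_apply_apply, inner_conj_symm]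
  have e2 : inner ℂ w ((InnerProductSpace.toDual ℂ H).symm (WeakDual.toStrongDual ℓ)) =
      (starRingEnd ℂ) (ℓ w) := by
    rw [← inner_conj_symm, InnerProductSpace.toDual_symm_apply]
    rfl
  rw [e2]
  simp only [e1]
  exact h2

theorem exists_weak_limit {α F : Type*} [MeasurableSpace α]
    [MeasurableSpace.CountablyGenerated α] {μ : Measure α} [SFinite μ]
    [NormedAddCommGroup F] [InnerProductSpace ℂ F] [CompleteSpace F]
    [TopologicalSpace.SeparableSpace F] {G : ℕ → α → F} (hG : ∀ n, MemLp (G n) 2 μ)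
    {C : ℝ} (hC : ∀ n, ∫ x, ‖G n x‖ ^ 2 ∂μ ≤ C) :
    ∃ (G' : α → F) (φ : ℕ → ℕ), MemLp G' 2 μ ∧ StrictMono φ ∧ ∀ V, MemLp V 2 μ →
      Tendsto (fun n => ∫ x, inner ℂ (V x) (G (φ n) x) ∂μ) atTop
        (𝓝 (∫ x, inner ℂ (V x) (G' x) ∂μ)) := by
  have h2 : Fact ((2 : ENNReal) ≠ ⊤) := ⟨ENNReal.ofNat_ne_top⟩
  obtain ⟨v, φ, hφ, h⟩ := exists_weakly_convergent_subseq (u := fun n => (hG n).toLp) (C := √C)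
    fun n => Real.le_sqrt_of_sq_le (by rw [sq_norm_toLp]; exact hC n)
  refine ⟨v, φ, Lp.memLp v, hφ, fun V hV => ?_⟩
  have := h hV.toLp
  simp only [integral_inner_toLp] at this
  rwa [← Lp.toLp_coeFn v (Lp.memLp v), integral_inner_toLp] at this

/-- Weak lower semicontinuity: pass to the limit in |⟨G', Gₙ⟩| ≤ (‖G'‖² + ‖Gₙ‖²)/2 and absorb ‖G'‖².
-/
theorem integral_sq_norm_le_of_weak_limit {α F : Type*} [MeasurableSpace α] {μ : Measure α}
    [NormedAddCommGroup F] [InnerProductSpace ℂ F] {G : ℕ → α → F} (hG : ∀ n, MemLp (G n) 2 μ)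
    {G' : α → F} (hG' : MemLp G' 2 μ)
    (h : Tendsto (fun n => ∫ x, inner ℂ (G' x) (G n x) ∂μ) atTop
        (𝓝 (∫ x, inner ℂ (G' x) (G' x) ∂μ))) {A : ℝ}
    (hA : Tendsto (fun n => ∫ x, ‖G n x‖ ^ 2 ∂μ) atTop (𝓝 A)) :
    ∫ x, ‖G' x‖ ^ 2 ∂μ ≤ A := by
  rw [← sq_norm_toLp hG']
  simp only [← sq_norm_toLp (hG _)] at hA
  rw [← integral_inner_toLp hG' hG'] at h
  simp only [← integral_inner_toLp hG' (hG _)] at h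
  have h1 := h.norm
  rw [inner_self_eq_norm_sq_to_K] at h1
  have h2 : ∀ n, ‖inner ℂ hG'.toLp (hG n).toLp‖ ≤
      (‖hG'.toLp‖ ^ 2 + ‖(hG n).toLp‖ ^ 2) / 2 := fun n =>
    (norm_inner_le_norm _ _).trans (by nlinarith [sq_nonneg (‖hG'.toLp‖ - ‖(hG n).toLp‖)])
  have h3 := le_of_tendsto_of_tendsto' h1 ((hA.const_add _).div_const 2) h2
  rw [norm_pow, RCLike.norm_ofReal, abs_norm] at h3
  linarith

/-- Fatou's lemma for convergent nonnegative integrals. -/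
theorem integrable_and_integral_le_of_tendsto {α : Type*} [MeasurableSpace α] {μ : Measure α}
    {h : ℕ → α → ℝ} {h' : α → ℝ} (hn : ∀ n x, 0 ≤ h n x) (hi : ∀ n, Integrable (h n) μ)
    (hl : ∀ᵐ x ∂μ, Tendsto (fun n => h n x) atTop (𝓝 (h' x))) {B : ℝ}
    (hB : Tendsto (fun n => ∫ x, h n x ∂μ) atTop (𝓝 B)) :
    Integrable h' μ ∧ ∫ x, h' x ∂μ ≤ B := by
  have hm : AEStronglyMeasurable h' μ := aestronglyMeasurable_of_tendsto_ae _ (fun n => (hi n).1) hl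
  have h0 : 0 ≤ᵐ[μ] h' := by
    filter_upwards [hl] with x hx using ge_of_tendsto' hx fun n => hn n x
  have hB0 : 0 ≤ B := ge_of_tendsto' hB fun n => integral_nonneg (hn n)
  have key : ∫⁻ x, ENNReal.ofReal (h' x) ∂μ ≤ ENNReal.ofReal B := by
    calc ∫⁻ x, ENNReal.ofReal (h' x) ∂μ
        = ∫⁻ x, liminf (fun n => ENNReal.ofReal (h n x)) atTop ∂μ := by
          refine lintegral_congr_ae ?_
          filter_upwards [hl] with x hx
          exact ((ENNReal.continuous_ofReal.tendsto _).comp hx).liminf_eq.symm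
      _ ≤ liminf (fun n => ∫⁻ x, ENNReal.ofReal (h n x) ∂μ) atTop :=
          lintegral_liminf_le' fun n => (hi n).1.aemeasurable.ennreal_ofReal
      _ = ENNReal.ofReal B := by
          simp only [← ofReal_integral_eq_lintegral_ofReal (hi _) (Eventually.of_forall (hn _))]
          exact ((ENNReal.continuous_ofReal.tendsto _).comp hB).liminf_eq
  have hint : Integrable h' μ := by
    refine ⟨hm, ?_⟩
    rw [hasFiniteIntegral_iff_ofReal h0]
    exact key.trans_lt ENNReal.ofReal_lt_top
  refine ⟨hint, ?_⟩
  rw [integral_eq_lintegral_of_nonneg_ae h0 hm]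
  exact ENNReal.toReal_le_of_le_ofReal hB0 key

/-! ### Hardy's inequality -/

theorem ae_ne_zero {d : ℕ} (hd : 3 ≤ d) : ∀ᵐ x : Space d, x ≠ 0 := by
  have := nontrivial_space hd
  simp [ae_iff]

theorem quasiMeasurePreserving_norm {d : ℕ} (hd : 3 ≤ d) :
    Measure.QuasiMeasurePreserving (fun x : Space d => ‖x‖) volume volume := by
  refine ⟨measurable_norm, Measure.AbsolutelyContinuous.mk fun s hs h0 => ?_⟩
  rw [Measure.map_apply measurable_norm hs, measure_eq_zero_iff_ae_notMem]
  exact ae_norm_of_ae_Ioi hd (p := fun r => r ∉ s)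
    (ae_restrict_of_ae (measure_eq_zero_iff_ae_notMem.1 h0))

/-- Hardy's inequality, in the form of an integrability statement. -/
theorem integrable_hardy {d : ℕ} (hd : 3 ≤ d) {G : Space d → EuclideanSpace ℂ (Fin d)}
    (hG : MemLp G 2 volume) :
    Integrable fun x : Space d => ‖profile G ‖x‖‖ ^ 2 / ‖x‖ ^ 2 := by
  have h3 : (3 : ℝ) ≤ d := by exact_mod_cast hd
  -- The bound with a = -1/2, divided by |x|², carries the power |x|^(1/2-d). Tonelli then works:
  -- integrating |x|^q over |x| < |y| gives a multiple of |y|^(1/2), which cancels the weight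
  -- |y|^(-1/2).
  set q : ℝ := 1 / 2 - d with hq
  have hdq : 0 < (d : ℝ) + q := by rw [hq]; linarith
  have hG2 : Integrable fun y => ‖G y‖ ^ 2 := (memLp_two_iff_integrable_sq_norm hG.1).1 hG
  set W : Space d × Space d → ℝ := fun z =>
    (Iio ‖z.2‖).indicator (fun s : ℝ => s ^ q) ‖z.1‖ * (‖z.2‖ ^ (-(1 / 2) : ℝ) * ‖G z.2‖ ^ 2) with hW
  have hWm : AEStronglyMeasurable W (volume.prod volume) := by
    have hs : MeasurableSet {z : Space d × Space d | ‖z.1‖ < ‖z.2‖} :=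
      measurableSet_lt (measurable_norm.comp measurable_fst) (measurable_norm.comp measurable_snd)
    have m1 : Measurable fun z : Space d × Space d => ‖z.1‖ ^ q := by fun_prop
    have m2 := (m1.indicator hs).aestronglyMeasurable
      (μ := (volume : Measure (Space d)).prod (volume : Measure (Space d)))
    have m3 : Measurable fun y : Space d => ‖y‖ ^ (-(1 / 2) : ℝ) := by fun_prop
    have m4 := (m3.aestronglyMeasurable.mul hG2.1).comp_snd (μ := (volume : Measure (Space d)))
    exact m2.mul m4
  have hx : ∀ᵐ y : Space d, Integrable (fun x => W (x, y)) := by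
    filter_upwards [ae_ne_zero hd] with y hy
    exact (integrable_norm_rpow_inside hd hdq (norm_pos_iff.2 hy)).mul_const
      (‖y‖ ^ (-(1 / 2) : ℝ) * ‖G y‖ ^ 2)
  have hWi : Integrable W (volume.prod volume) := by
    rw [integrable_prod_iff' hWm]
    refine ⟨hx, ?_⟩
    refine (hG2.const_mul (sphereArea d / (1 / 2))).congr ?_
    filter_upwards [ae_ne_zero hd] with y hy
    have hy0 : 0 < ‖y‖ := norm_pos_iff.2 hy
    have e : ∀ x : Space d, ‖W (x, y)‖ = W (x, y) := fun x => by
      refine Real.norm_of_nonneg (mul_nonneg ?_ (by positivity))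
      by_cases hs : ‖x‖ ∈ Iio ‖y‖
      · rw [indicator_of_mem hs]; positivity
      · rw [indicator_of_notMem hs]
    simp only [e]
    simp only [hW]
    rw [integral_mul_const, integral_norm_rpow_inside hd hdq hy0]
    have e2 : (d : ℝ) + q = 1 / 2 := by rw [hq]; ring
    rw [e2]
    have e3 : ‖y‖ ^ (1 / 2 : ℝ) * ‖y‖ ^ (-(1 / 2) : ℝ) = 1 := by
      rw [← Real.rpow_add hy0]; simp
    linear_combination -(sphereArea d / (1 / 2) * ‖G y‖ ^ 2) * e3
  have hΦ := hWi.integral_prod_left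
  have hm : AEStronglyMeasurable (fun x : Space d => ‖profile G ‖x‖‖ ^ 2 / ‖x‖ ^ 2) volume :=
    (((aestronglyMeasurable_profile hG.1).comp_quasiMeasurePreserving
      (quasiMeasurePreserving_norm hd)).norm.aemeasurable.pow_const 2 |>.div
        (by fun_prop)).aestronglyMeasurable
  refine (hΦ.const_mul ((sphereArea d * (d - 2 + -(1 / 2)))⁻¹)).mono' hm ?_
  filter_upwards [ae_ne_zero hd] with x hx0
  have hx0 : 0 < ‖x‖ := norm_pos_iff.2 hx0
  rw [Real.norm_of_nonneg (by positivity)]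
  have h1 := sq_norm_profile_le hd hG (a := -(1 / 2)) (by norm_num) (by linarith) hx0
  have e : ∫ y, W (x, y) = ‖x‖ ^ q *
      ∫ y : Space d, (Ioi ‖x‖).indicator (fun s : ℝ => s ^ (-(1 / 2) : ℝ)) ‖y‖ * ‖G y‖ ^ 2 := by
    rw [← integral_const_mul]
    congr 1
    ext y
    by_cases hy : ‖x‖ < ‖y‖
    · simp [hW, hy]
    · simp [hW, hy]
  rw [e, div_le_iff₀ (by positivity)]
  refine h1.trans_eq ?_
  have e4 : ‖x‖ ^ (2 - d - -(1 / 2) : ℝ) = ‖x‖ ^ q * ‖x‖ ^ 2 := by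
    rw [← Real.rpow_natCast, ← Real.rpow_add hx0]
    congr 1
    rw [hq]; push_cast; ring
  rw [e4]
  ring


/-! ### Energy, decay and subcritical integrability on radial H¹ -/

theorem weakGradient_spec {d : ℕ} {f : Space d → ℂ} (hf : HasL2WeakGradient f) :
    MemLp (weakGradient f) 2 volume ∧ IsWeakGradient f (weakGradient f) := by
  rw [weakGradient, dif_pos hf]
  exact hf.choose_spec

theorem ae_eq_profile_weakGradient {d : ℕ} (hd : 3 ≤ d) {f : Space d → ℂ} (hf : MemH1 f)
    (hr : IsRadial f) : ∀ᵐ x, f x = profile (weakGradient f) ‖x‖ :=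
  ae_eq_profile hd hf.1 (weakGradient_spec hf.2).1 (weakGradient_spec hf.2).2 hr

/-- Fatou's lemma requires this integrability for the potential energies; the Hardy constant plays
no role. -/
theorem integrable_potential {d : ℕ} (hd : 3 ≤ d) {f : Space d → ℂ} (hf : MemH1 f)
    (hr : IsRadial f) (γ : ℝ) : Integrable fun x => γ / ‖x‖ ^ 2 * ‖f x‖ ^ 2 := by
  refine ((integrable_hardy hd (weakGradient_spec hf.2).1).const_mul γ).congr ?_
  filter_upwards [ae_eq_profile_weakGradient hd hf hr] with x hx
  rw [← hx]
  ring

theorem integral_potential_nonneg {d : ℕ} {γ : ℝ} (hγ : 0 < γ) (f : Space d → ℂ) :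
    0 ≤ ∫ x, γ / ‖x‖ ^ 2 * ‖f x‖ ^ 2 :=
  integral_nonneg fun _ => by positivity

theorem integral_sq_weakGradient_le {d : ℕ} {γ : ℝ} (hγ : 0 < γ) (f : Space d → ℂ) :
    ∫ x, ‖weakGradient f x‖ ^ 2 ≤ potentialForm γ f :=
  le_add_of_nonneg_right (integral_potential_nonneg hγ f)

/-- The constant in the radial decay estimate for functions of unit energy. -/
noncomputable def decayConst (d : ℕ) : ℝ := √((sphereArea d * (d - 2))⁻¹)

theorem ae_norm_le_of_energy_le_one {d : ℕ} (hd : 3 ≤ d) {f : Space d → ℂ} (hf : MemH1 f)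
    (hr : IsRadial f) (h1 : ∫ x, ‖weakGradient f x‖ ^ 2 ≤ 1) :
    ∀ᵐ x, ‖f x‖ ≤ decayConst d * ‖x‖ ^ (-(((d : ℝ) - 2) / 2)) := by
  have h3 : (3 : ℝ) ≤ d := by exact_mod_cast hd
  have hσ := sphereArea_pos hd
  filter_upwards [ae_eq_profile_weakGradient hd hf hr, ae_ne_zero hd] with x hx h0
  rw [hx]
  refine (norm_profile_le hd (weakGradient_spec hf.2).1 (norm_pos_iff.2 h0)).trans ?_
  refine mul_le_mul_of_nonneg_right (Real.sqrt_le_sqrt ?_) (by positivity)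
  refine mul_le_of_le_one_right (inv_nonneg.2 (mul_nonneg hσ.le ?_)) h1
  linarith

theorem mass_pos {d : ℕ} {f : Space d → ℂ} (hf : MemLp f 2 volume) (h0 : ¬ f =ᵐ[volume] 0) :
    0 < ∫ x, ‖f x‖ ^ 2 := by
  refine lt_of_le_of_ne (integral_nonneg fun _ => sq_nonneg _) fun h => h0 ?_
  have h2 := (integral_eq_zero_iff_of_nonneg (fun x => sq_nonneg ‖f x‖)
    ((memLp_two_iff_integrable_sq_norm hf.1).1 hf)).1 h.symm
  filter_upwards [h2] with x hx
  simpa using hx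

/-- If the gradient energy vanished, the decay estimate would force f = 0. -/
theorem potentialForm_pos {d : ℕ} (hd : 3 ≤ d) {γ : ℝ} (hγ : 0 < γ) {f : Space d → ℂ}
    (hf : MemH1RadNonzero f) : 0 < potentialForm γ f := by
  refine lt_of_lt_of_le ?_ (integral_sq_weakGradient_le hγ f)
  refine lt_of_le_of_ne (integral_nonneg fun _ => sq_nonneg _) fun h => hf.2.2 ?_
  have hd0 : ∀ᵐ x, ‖f x‖ = 0 := by
    filter_upwards [ae_eq_profile_weakGradient hd hf.1 hf.2.1, ae_ne_zero hd] with x hx h0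
    have := norm_profile_le hd (weakGradient_spec hf.1.2).1 (norm_pos_iff.2 h0)
    rw [← h, mul_zero, Real.sqrt_zero, zero_mul, ← hx] at this
    exact le_antisymm this (norm_nonneg _)
  filter_upwards [hd0] with x hx
  simpa using hx

/-- Beyond radius R the factor v^(p-1) is at most (C R^(-e))^(p-1). Integrated, the tail is the mass
times a factor tending to zero as R grows. -/
theorem rpow_le_of_le {C R p e v r : ℝ} (hC : 0 ≤ C) (hR : 0 < R) (hp : 1 < p) (he : 0 < e)
    (hv : 0 ≤ v) (h : v ≤ C * r ^ (-e)) :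
    v ^ (p + 1) ≤ (if r < R then v ^ (p + 1) else 0) + (C * R ^ (-e)) ^ (p - 1) * v ^ 2 := by
  split_ifs with hrR
  · exact le_add_of_nonneg_right (by positivity)
  · rw [zero_add]
    have h1 : v ≤ C * R ^ (-e) := h.trans (mul_le_mul_of_nonneg_left
      (Real.rpow_le_rpow_of_nonpos hR (not_lt.1 hrR) (by linarith)) hC)
    have h2 : v ^ (p + 1) = v ^ (p - 1) * v ^ 2 := by
      rw [← Real.rpow_natCast v 2, ← Real.rpow_add' hv (by push_cast; linarith)]
      congr 1; push_cast; ring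
    rw [h2]
    exact mul_le_mul_of_nonneg_right (Real.rpow_le_rpow hv h1 (by linarith)) (sq_nonneg v)

theorem ite_rpow_le_of_le {C R p e v r : ℝ} (hC : 0 ≤ C) (hp : 1 < p)
    (hr : 0 < r) (hv : 0 ≤ v) (h : v ≤ C * r ^ (-e)) :
    (if r < R then v ^ (p + 1) else 0) ≤
      C ^ (p + 1) * (Iio R).indicator (fun s : ℝ => s ^ (-e * (p + 1))) r := by
  split_ifs with hrR
  · rw [indicator_of_mem (show r ∈ Iio R from hrR), Real.rpow_mul hr.le,
      ← Real.mul_rpow hC (by positivity)]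
    exact Real.rpow_le_rpow hv h (by linarith)
  · rw [indicator_of_notMem (show r ∉ Iio R from hrR), mul_zero]

/-- Energy-subcriticality is exactly integrability at the origin of the envelope |x|^(-(d-2)/2)
raised to the power p + 1. The quantity is also twice the mass exponent a of the Gagliardo-Nirenberg
inequality. -/
theorem subcritical_exponent {d : ℕ} (hd : 3 ≤ d) {p : ℝ} (hp : p < 1 + 4 / ((d : ℝ) - 2)) :
    0 < (d : ℝ) + -(((d : ℝ) - 2) / 2) * (p + 1) := by
  have h3 : (3 : ℝ) ≤ d := by exact_mod_cast hd
  have h2 : 0 < (d : ℝ) - 2 := by linarith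
  have : (p - 1) * ((d : ℝ) - 2) < 4 := by
    rw [← lt_div_iff₀ h2]; linarith
  nlinarith

theorem aestronglyMeasurable_norm_rpow {d : ℕ} {f : Space d → ℂ}
    (hf : AEStronglyMeasurable f volume) (q : ℝ) :
    AEStronglyMeasurable (fun x => ‖f x‖ ^ q) volume :=
  (hf.norm.aemeasurable.pow_const q).aestronglyMeasurable

theorem integrable_ite_rpow {d : ℕ} (hd : 3 ≤ d) {p : ℝ} (hp : 1 < p)
    (hp' : p < 1 + 4 / ((d : ℝ) - 2)) {f : Space d → ℂ} (hf : AEStronglyMeasurable f volume)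
    {C R : ℝ} (hC : 0 ≤ C) (hR : 0 < R)
    (h : ∀ᵐ x, ‖f x‖ ≤ C * ‖x‖ ^ (-(((d : ℝ) - 2) / 2))) :
    Integrable fun x => if ‖x‖ < R then ‖f x‖ ^ (p + 1) else 0 := by
  have hm : AEStronglyMeasurable (fun x => if ‖x‖ < R then ‖f x‖ ^ (p + 1) else 0) volume :=
    (aestronglyMeasurable_norm_rpow hf (p + 1)).indicator
      (measurableSet_lt measurable_norm measurable_const)
  refine ((integrable_norm_rpow_inside hd (subcritical_exponent hd hp') hR).const_mul
    (C ^ (p + 1))).mono' hm ?_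
  filter_upwards [h, ae_ne_zero hd] with x hx h0
  rw [Real.norm_of_nonneg (by positivity)]
  exact ite_rpow_le_of_le hC hp (norm_pos_iff.2 h0) (norm_nonneg _) hx

theorem integrable_norm_rpow {d : ℕ} (hd : 3 ≤ d) {p : ℝ} (hp : 1 < p)
    (hp' : p < 1 + 4 / ((d : ℝ) - 2)) {f : Space d → ℂ} (hf : MemLp f 2 volume)
    {C : ℝ} (hC : 0 ≤ C) (h : ∀ᵐ x, ‖f x‖ ≤ C * ‖x‖ ^ (-(((d : ℝ) - 2) / 2))) :
    Integrable fun x => ‖f x‖ ^ (p + 1) := by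
  have h3 : (3 : ℝ) ≤ d := by exact_mod_cast hd
  refine ((integrable_ite_rpow hd hp hp' hf.1 hC one_pos h).add
    (((memLp_two_iff_integrable_sq_norm hf.1).1 hf).const_mul
      ((C * 1 ^ (-(((d : ℝ) - 2) / 2))) ^ (p - 1)))).mono'
    (aestronglyMeasurable_norm_rpow hf.1 _) ?_
  filter_upwards [h] with x hx
  rw [Real.norm_of_nonneg (by positivity)]
  exact rpow_le_of_le hC one_pos hp (by linarith) (norm_nonneg _) hx

theorem integral_norm_rpow_le {d : ℕ} (hd : 3 ≤ d) {p : ℝ} (hp : 1 < p)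
    (hp' : p < 1 + 4 / ((d : ℝ) - 2)) {f : Space d → ℂ} (hf : MemLp f 2 volume)
    {C R : ℝ} (hC : 0 ≤ C) (hR : 0 < R) (h : ∀ᵐ x, ‖f x‖ ≤ C * ‖x‖ ^ (-(((d : ℝ) - 2) / 2))) :
    ∫ x, ‖f x‖ ^ (p + 1) ≤ (∫ x, if ‖x‖ < R then ‖f x‖ ^ (p + 1) else 0) +
      (C * R ^ (-(((d : ℝ) - 2) / 2))) ^ (p - 1) * ∫ x, ‖f x‖ ^ 2 := by
  have h3 : (3 : ℝ) ≤ d := by exact_mod_cast hd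
  have i1 := integrable_ite_rpow hd hp hp' hf.1 hC hR h
  have i2 := ((memLp_two_iff_integrable_sq_norm hf.1).1 hf).const_mul
      ((C * R ^ (-(((d : ℝ) - 2) / 2))) ^ (p - 1))
  rw [← integral_const_mul, ← integral_add i1 i2]
  refine integral_mono_ae (integrable_norm_rpow hd hp hp' hf hC h) (i1.add i2) ?_
  filter_upwards [h] with x hx
  exact rpow_le_of_le hC hR hp (by linarith) (norm_nonneg _) hx

/-! ### Compactness of radial sequences -/

theorem tendsto_integral_smul_of_decay {d : ℕ} (hd : 3 ≤ d) {f : ℕ → Space d → ℂ}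
    {f' : Space d → ℂ} (hm : ∀ n, AEStronglyMeasurable (f n) volume) {C : ℝ}
    (hb : ∀ n, ∀ᵐ x, ‖f n x‖ ≤ C * ‖x‖ ^ (-(((d : ℝ) - 2) / 2)))
    (hl : ∀ᵐ x, Tendsto (fun n => f n x) atTop (𝓝 (f' x))) {φ : Space d → ℝ}
    (hφ : Continuous φ) (hc : HasCompactSupport φ) :
    Tendsto (fun n => ∫ x, φ x • f n x) atTop (𝓝 (∫ x, φ x • f' x)) := by
  have h3 : (3 : ℝ) ≤ d := by exact_mod_cast hd
  obtain ⟨B, hB⟩ := hφ.bounded_above_of_compact_support hc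
  obtain ⟨R, hR⟩ := hc.isCompact.isBounded.subset_ball (0 : Space d)
  have hR' : tsupport φ ⊆ Metric.ball 0 (max R 1) :=
    hR.trans (Metric.ball_subset_ball (le_max_left _ _))
  have hint := (integrable_norm_rpow_inside hd (q := -(((d : ℝ) - 2) / 2)) (R := max R 1)
    (by linarith) (by positivity)).const_mul (B * C)
  refine tendsto_integral_of_dominated_convergence _
    (fun n => hφ.aestronglyMeasurable.smul (hm n)) hint (fun n => ?_) ?_
  · filter_upwards [hb n] with x hx
    rw [norm_smul]
    by_cases h : x ∈ tsupport φ
    · have : ‖x‖ ∈ Iio (max R 1) := by simpa using hR' h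
      rw [indicator_of_mem this, mul_assoc]
      exact mul_le_mul (hB x) hx (norm_nonneg _) ((norm_nonneg _).trans (hB x))
    · rw [image_eq_zero_of_notMem_tsupport h, norm_zero, zero_mul]
      by_cases h' : ‖x‖ ∈ Iio (max R 1)
      · rw [indicator_of_mem h', mul_assoc]
        exact mul_nonneg ((norm_nonneg _).trans (hB x)) ((norm_nonneg _).trans hx)
      · rw [indicator_of_notMem h', mul_zero]
  · filter_upwards [hl] with x hx using hx.const_smul _

/-- The side containing f converges by domination with the locally integrable envelope; the other is
the weak convergence tested against φ eᵢ. -/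
theorem isWeakGradient_of_weak_limit {d : ℕ} (hd : 3 ≤ d) {f : ℕ → Space d → ℂ}
    {f' : Space d → ℂ} (hm : ∀ n, AEStronglyMeasurable (f n) volume) {C : ℝ}
    (hb : ∀ n, ∀ᵐ x, ‖f n x‖ ≤ C * ‖x‖ ^ (-(((d : ℝ) - 2) / 2)))
    (hl : ∀ᵐ x, Tendsto (fun n => f n x) atTop (𝓝 (f' x)))
    {G : ℕ → Space d → EuclideanSpace ℂ (Fin d)} {G' : Space d → EuclideanSpace ℂ (Fin d)}
    (hG : ∀ n, IsWeakGradient (f n) (G n))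
    (hw : ∀ V, MemLp V 2 volume → Tendsto (fun n => ∫ x, inner ℂ (V x) (G n x)) atTop
        (𝓝 (∫ x, inner ℂ (V x) (G' x)))) : IsWeakGradient f' G' := by
  intro φ hφ hc i
  have h1 := tendsto_integral_smul_of_decay hd hm hb hl
    (φ := fun x => fderiv ℝ φ x (EuclideanSpace.single i 1))
    ((hφ.continuous_fderiv (by simp)).clm_apply continuous_const) (hc.fderiv_apply (𝕜 := ℝ) _)
  have hV : MemLp (fun x => φ x • (EuclideanSpace.single i (1 : ℂ))) 2 volume :=
    (hφ.continuous.smul continuous_const).memLp_of_hasCompactSupport hc.smul_right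
  have e : ∀ v : EuclideanSpace ℂ (Fin d), ∀ x,
      inner ℂ (φ x • (EuclideanSpace.single i (1 : ℂ))) v = φ x • v i := by
    intro v x
    rw [inner_smul_left_eq_smul, EuclideanSpace.inner_single_left]
    simp
  have h2 := hw _ hV
  simp only [e] at h2
  have h3 : ∀ n, ∫ x, (fderiv ℝ φ x (EuclideanSpace.single i 1)) • f n x =
      -∫ x, φ x • G n x i := fun n => hG n φ hφ hc i
  simp only [h3] at h1
  exact tendsto_nhds_unique h1 h2.neg


/-- Compactness of normalized radial sequences, up to the loss of mass and energy. -/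
theorem exists_limit_of_normalized {d : ℕ} (hd : 3 ≤ d) {γ : ℝ} (hγ : 0 < γ) {p : ℝ} (hp : 1 < p)
    (hp' : p < 1 + 4 / ((d : ℝ) - 2)) {f : ℕ → Space d → ℂ} (hf : ∀ n, MemH1 (f n))
    (hr : ∀ n, IsRadial (f n)) (hM : ∀ n, ∫ x, ‖f n x‖ ^ 2 = 1)
    (hP : ∀ n, potentialForm γ (f n) = 1) {s : ℝ}
    (hs : Tendsto (fun n => ∫ x, ‖f n x‖ ^ (p + 1)) atTop (𝓝 s)) :
    ∃ g : Space d → ℂ, MemH1 g ∧ IsRadial g ∧ ∫ x, ‖g x‖ ^ 2 ≤ 1 ∧ potentialForm γ g ≤ 1 ∧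
      s ≤ ∫ x, ‖g x‖ ^ (p + 1) := by
  have h3 : (3 : ℝ) ≤ d := by exact_mod_cast hd
  have hE : ∀ n, ∫ x, ‖weakGradient (f n) x‖ ^ 2 ≤ 1 := fun n =>
    (integral_sq_weakGradient_le hγ (f n)).trans (hP n).le
  -- Only the sum of gradient and potential energies is normalized. Making the first converge to A
  -- makes the second converge to 1 - A, so lower semicontinuity applies to each.
  obtain ⟨A, -, ψ, hψ, hA⟩ := isCompact_Icc.tendsto_subseq
    (x := fun n => ∫ x, ‖weakGradient (f n) x‖ ^ 2) (s := Icc 0 1)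
    fun n => ⟨integral_nonneg fun _ => sq_nonneg _, hE n⟩
  obtain ⟨G, χ, hG, hχ, hw⟩ := exists_weak_limit
    (G := fun n => weakGradient (f (ψ n))) (fun n => (weakGradient_spec (hf _).2).1)
    (fun n => hE (ψ n))
  set θ : ℕ → ℕ := ψ ∘ χ with hθ
  have hθt : Tendsto θ atTop atTop := (hψ.comp hχ).tendsto_atTop
  have hAθ : Tendsto (fun n => ∫ x, ‖weakGradient (f (θ n)) x‖ ^ 2) atTop (𝓝 A) :=
    hA.comp hχ.tendsto_atTop
  have hGA : ∫ x, ‖G x‖ ^ 2 ≤ A := integral_sq_norm_le_of_weak_limit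
    (fun n => (weakGradient_spec (hf (θ n)).2).1) hG (hw G hG) hAθ
  set g : Space d → ℂ := fun x => profile G ‖x‖ with hg
  have hgm : AEStronglyMeasurable g volume :=
    (aestronglyMeasurable_profile hG.1).comp_quasiMeasurePreserving (quasiMeasurePreserving_norm hd)
  -- The value at x is a pairing of the gradient with `radialKernel`, so weak convergence gives
  -- pointwise convergence.
  have hl : ∀ᵐ x, Tendsto (fun n => f (θ n) x) atTop (𝓝 (g x)) := by
    filter_upwards [ae_all_iff.2 fun n => ae_eq_profile_weakGradient hd (hf n) (hr n),
      ae_ne_zero hd] with x hx h0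
    simp only [hx]
    exact (hw _ (memLp_radialKernel hd (norm_pos_iff.2 h0))).const_smul _
  have hb : ∀ n, ∀ᵐ x, ‖f (θ n) x‖ ≤ decayConst d * ‖x‖ ^ (-(((d : ℝ) - 2) / 2)) := fun n =>
    ae_norm_le_of_energy_le_one hd (hf _) (hr _) (hE _)
  have hgb : ∀ᵐ x, ‖g x‖ ≤ decayConst d * ‖x‖ ^ (-(((d : ℝ) - 2) / 2)) := by
    filter_upwards [hl, ae_all_iff.2 hb] with x hx hbx
    exact le_of_tendsto' hx.norm hbx
  have hgG : IsWeakGradient g G := isWeakGradient_of_weak_limit hd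
    (fun n => (hf (θ n)).1.1) hb hl (fun n => (weakGradient_spec (hf (θ n)).2).2) hw
  have hmass := integrable_and_integral_le_of_tendsto (h := fun n x => ‖f (θ n) x‖ ^ 2)
    (h' := fun x => ‖g x‖ ^ 2) (B := 1) (fun n x => sq_nonneg _)
    (fun n => (memLp_two_iff_integrable_sq_norm (hf _).1.1).1 (hf _).1)
    (by filter_upwards [hl] with x hx using hx.norm.pow 2) (by simp [hM])
  have hpot := integrable_and_integral_le_of_tendsto
    (h := fun n x => γ / ‖x‖ ^ 2 * ‖f (θ n) x‖ ^ 2)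
    (h' := fun x => γ / ‖x‖ ^ 2 * ‖g x‖ ^ 2) (B := 1 - A) (fun n x => by positivity)
    (fun n => integrable_potential hd (hf _) (hr _) γ)
    (by filter_upwards [hl] with x hx using (hx.norm.pow 2).const_mul _) (by
      refine (hAθ.const_sub 1).congr fun n => ?_
      have := hP (θ n)
      rw [potentialForm] at this
      linarith)
  have hgL : MemLp g 2 volume := (memLp_two_iff_integrable_sq_norm hgm).2 hmass.1
  have hC : 0 ≤ decayConst d := Real.sqrt_nonneg _
  refine ⟨g, ⟨hgL, G, hG, hgG⟩, ⟨profile G, Eventually.of_forall fun x => rfl⟩, hmass.2, ?_, ?_⟩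
  · have e : ∫ x, ‖weakGradient g x‖ ^ 2 = ∫ x, ‖G x‖ ^ 2 := by
      refine integral_congr_ae ?_
      filter_upwards [weakGradient_ae_eq hG hgG] with x hx
      rw [hx]
    rw [potentialForm, e]
    linarith [hpot.2]
  · have hsθ := hs.comp hθt
    have hgi := integrable_norm_rpow hd hp hp' hgL hC hgb
    -- Inside radius R dominated convergence applies; outside, unit mass gives a tail bound uniform
    -- in n. Finally R tends to infinity.
    have key : ∀ R : ℝ, 0 < R → s ≤ (∫ x, ‖g x‖ ^ (p + 1)) +
        (decayConst d * R ^ (-(((d : ℝ) - 2) / 2))) ^ (p - 1) := by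
      intro R hR
      have hdct : Tendsto (fun n => ∫ x, if ‖x‖ < R then ‖f (θ n) x‖ ^ (p + 1) else 0) atTop
          (𝓝 (∫ x, if ‖x‖ < R then ‖g x‖ ^ (p + 1) else 0)) := by
        refine tendsto_integral_of_dominated_convergence _
          (fun n => (integrable_ite_rpow hd hp hp' (hf (θ n)).1.1 hC hR (hb n)).1)
          ((integrable_norm_rpow_inside hd (subcritical_exponent hd hp') hR).const_mul
            (decayConst d ^ (p + 1))) (fun n => ?_) ?_
        · filter_upwards [hb n, ae_ne_zero hd] with x hx h0
          rw [Real.norm_of_nonneg (by positivity)]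
          exact ite_rpow_le_of_le hC hp (norm_pos_iff.2 h0) (norm_nonneg _) hx
        · filter_upwards [hl] with x hx
          split_ifs
          · exact hx.norm.rpow_const (Or.inr (by linarith))
          · exact tendsto_const_nhds
      refine (le_of_tendsto_of_tendsto' hsθ (hdct.add_const _) fun n => ?_).trans
        (add_le_add_left (integral_mono_of_nonneg (Eventually.of_forall fun x => by positivity) hgi
          (Eventually.of_forall fun x => ?_)) _)
      · have := integral_norm_rpow_le hd hp hp' (hf (θ n)).1 hC hR (hb n)
        rwa [hM, mul_one] at this
      · dsimp only
        split_ifs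
        · exact le_rfl
        · positivity
    have hlim : Tendsto (fun R : ℝ => (∫ x, ‖g x‖ ^ (p + 1)) +
        (decayConst d * R ^ (-(((d : ℝ) - 2) / 2))) ^ (p - 1)) atTop
        (𝓝 (∫ x, ‖g x‖ ^ (p + 1))) := by
      have h1 := ((tendsto_rpow_neg_atTop (show 0 < ((d : ℝ) - 2) / 2 by linarith)).const_mul
        (decayConst d)).rpow_const (p := p - 1) (Or.inr (by linarith))
      rw [mul_zero, Real.zero_rpow (by linarith)] at h1
      simpa using h1.const_add (∫ x, ‖g x‖ ^ (p + 1))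
    exact ge_of_tendsto hlim ((eventually_gt_atTop 0).mono key)

/-- The same splitting at R = 1, to make the supremum defining the Gagliardo-Nirenberg constant
finite. -/
theorem exists_bound_of_normalized {d : ℕ} (hd : 3 ≤ d) {γ : ℝ} (hγ : 0 < γ) {p : ℝ} (hp : 1 < p)
    (hp' : p < 1 + 4 / ((d : ℝ) - 2)) :
    ∃ B : ℝ, ∀ f : Space d → ℂ, MemH1 f → IsRadial f → ∫ x, ‖f x‖ ^ 2 = 1 →
      potentialForm γ f = 1 → ∫ x, ‖f x‖ ^ (p + 1) ≤ B := by
  have hC : 0 ≤ decayConst d := Real.sqrt_nonneg _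
  refine ⟨(∫ x : Space d, decayConst d ^ (p + 1) * (Iio (1 : ℝ)).indicator
    (fun s : ℝ => s ^ (-(((d : ℝ) - 2) / 2) * (p + 1))) ‖x‖) +
      (decayConst d * 1 ^ (-(((d : ℝ) - 2) / 2))) ^ (p - 1), fun f hf hr hM hP => ?_⟩
  have hb := ae_norm_le_of_energy_le_one hd hf hr
    ((integral_sq_weakGradient_le hγ f).trans hP.le)
  have h1 := integral_norm_rpow_le hd hp hp' hf.1 hC one_pos hb
  rw [hM, mul_one] at h1
  refine h1.trans (add_le_add_left ?_ _)
  refine integral_mono_ae (integrable_ite_rpow hd hp hp' hf.1.1 hC one_pos hb)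
    ((integrable_norm_rpow_inside hd (subcritical_exponent hd hp') one_pos).const_mul _) ?_
  filter_upwards [hb, ae_ne_zero hd] with x hx h0
  exact ite_rpow_le_of_le hC hp (norm_pos_iff.2 h0) (norm_nonneg _) hx


/-! ### Scaling and the Gagliardo-Nirenberg optimizer -/

theorem memH1_of_contDiff {d : ℕ} {f : Space d → ℂ} (hf : ContDiff ℝ (⊤ : ℕ∞) f)
    (hc : HasCompactSupport f) : MemH1 f := by
  have h1 : ∀ i : Fin d, Continuous fun x => fderiv ℝ f x (EuclideanSpace.single i 1) := fun i =>
    (hf.continuous_fderiv (by simp)).clm_apply continuous_const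
  refine ⟨hf.continuous.memLp_of_hasCompactSupport hc,
    fun x => WithLp.toLp 2 fun i => fderiv ℝ f x (EuclideanSpace.single i 1), ?_, ?_⟩
  · refine Continuous.memLp_of_hasCompactSupport ?_ ?_
    · exact (PiLp.continuous_toLp 2 _).comp (continuous_pi h1)
    · refine (hc.fderiv (𝕜 := ℝ)).mono fun x hx => ?_
      rw [Function.mem_support] at hx ⊢
      contrapose! hx
      ext i
      simp [hx]
  · intro φ hφ hφc i
    have h2 : Continuous fun x => fderiv ℝ φ x (EuclideanSpace.single i 1) :=
      (hφ.continuous_fderiv (by simp)).clm_apply continuous_const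
    rw [eq_comm, neg_eq_iff_eq_neg]
    refine integral_smul_fderiv_eq_neg_fderiv_smul_of_integrable ?_ ?_ ?_
      (fun x _ => hφ.differentiable (by simp) x) (fun x _ => hf.differentiable (by simp) x)
    · exact (h2.smul hf.continuous).integrable_of_hasCompactSupport hc.smul_left
    · exact (hφ.continuous.smul (h1 i)).integrable_of_hasCompactSupport hφc.smul_right
    · exact (hφ.continuous.smul hf.continuous).integrable_of_hasCompactSupport hc.smul_left

theorem exists_memH1RadNonzero (d : ℕ) : ∃ f : Space d → ℂ, MemH1RadNonzero f := by
  -- A bump depending on |x|² is smooth at the origin as well.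
  set u : ℝ → ℂ := fun r => (expNegInvGlue (1 - r ^ 2) : ℂ) with hu
  have hd1 : ContDiff ℝ (⊤ : ℕ∞) fun x : Space d => u ‖x‖ :=
    Complex.ofRealCLM.contDiff.comp
      (expNegInvGlue.contDiff.comp (contDiff_const.sub (contDiff_norm_sq ℝ)))
  have hc : HasCompactSupport fun x : Space d => u ‖x‖ := by
    refine HasCompactSupport.intro (isCompact_closedBall (0 : Space d) 1) fun x hx => ?_
    have hx1 : 1 < ‖x‖ := by simpa using hx
    simp only [hu]
    rw [expNegInvGlue.zero_of_nonpos (by nlinarith), Complex.ofReal_zero]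
  refine ⟨fun x => u ‖x‖, memH1_of_contDiff hd1 hc, ⟨u, Eventually.of_forall fun _ => rfl⟩,
    fun h => ?_⟩
  have h0 := congrFun ((hd1.continuous.ae_eq_iff_eq volume continuous_zero).1 h) 0
  have hpos : 0 < expNegInvGlue 1 := expNegInvGlue.pos_of_pos one_pos
  simp [hu, hpos.ne'] at h0

theorem memH1_rescale {d : ℕ} {f : Space d → ℂ} (hf : MemH1 f) (α β s : ℝ) :
    MemH1 (rescale α β s f) := by
  obtain ⟨hL, G, hG, h⟩ := hf
  have hb := Real.exp_pos (β * s)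
  exact ⟨(memLp_comp_smul hL hb.ne').const_smul (Real.exp (α * s)), _,
    (memLp_comp_smul hG hb.ne').const_smul (Real.exp (α * s) * Real.exp (β * s)),
    h.rescale (Real.exp (α * s)) hb⟩

theorem isRadial_rescale {d : ℕ} {f : Space d → ℂ} (hf : IsRadial f) (α β s : ℝ) :
    IsRadial (rescale α β s f) := by
  obtain ⟨g, hg⟩ := hf
  have hb := Real.exp_pos (β * s)
  have hq : Measure.QuasiMeasurePreserving (fun x : Space d => Real.exp (β * s) • x)
      volume volume := by
    refine ⟨measurable_const_smul _, ?_⟩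
    have := Measure.map_addHaar_smul (volume : Measure (Space d)) hb.ne'
    rw [this]
    exact Measure.smul_absolutelyContinuous
  refine ⟨fun r => Real.exp (α * s) • g (Real.exp (β * s) * r), ?_⟩
  filter_upwards [hq.ae hg] with x hx
  rw [rescale, hx, norm_smul, Real.norm_of_nonneg hb.le]

theorem integral_sq_rescale {d : ℕ} (f : Space d → ℂ) (α β s : ℝ) :
    ∫ x, ‖rescale α β s f x‖ ^ 2 = Real.exp ((2 * α - d * β) * s) * ∫ x, ‖f x‖ ^ 2 := by
  simpa only [Real.rpow_two] using integral_norm_rpow_rescale f α β s 2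

theorem potentialForm_rescale {d : ℕ} {f : Space d → ℂ} (hf : MemH1 f) (γ α β s : ℝ) :
    potentialForm γ (rescale α β s f) =
      Real.exp ((2 * α - (d - 2) * β) * s) * potentialForm γ f := by
  rw [potentialForm, potentialForm, integral_weakGradient_rescale hf.2, integral_potential_rescale,
    mul_add]

theorem memH1RadNonzero_rescale {d : ℕ} {f : Space d → ℂ} (hf : MemH1RadNonzero f) (α β s : ℝ) :
    MemH1RadNonzero (rescale α β s f) := by
  refine ⟨memH1_rescale hf.1 α β s, isRadial_rescale hf.2.1 α β s, fun h0 => ?_⟩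
  have h1 := mass_pos hf.1.1 hf.2.2
  have h2 := integral_sq_rescale f α β s
  have h3 : ∫ x, ‖rescale α β s f x‖ ^ 2 = 0 := by
    have : ∫ x, ‖rescale α β s f x‖ ^ 2 = ∫ _x : Space d, (0 : ℝ) := by
      refine integral_congr_ae ?_
      filter_upwards [h0] with x hx
      simp [hx]
    simpa using this
  rw [h3] at h2
  exact (mul_pos (Real.exp_pos _) h1).ne h2

/-- The two-parameter scaling realizes every mass and energy. -/
theorem exists_rescale {d : ℕ} (hd : 3 ≤ d) {γ : ℝ} (hγ : 0 < γ) {f : Space d → ℂ}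
    (hf : MemH1RadNonzero f) {A B : ℝ} (hA : 0 < A) (hB : 0 < B) (p : ℝ) :
    ∃ g : Space d → ℂ, MemH1RadNonzero g ∧ ∫ x, ‖g x‖ ^ 2 = A ∧ potentialForm γ g = B ∧
      ∫ x, ‖g x‖ ^ (p + 1) = (A / ∫ x, ‖f x‖ ^ 2) ^ ((p + 1) / 2 - d * (p - 1) / 4) *
        (B / potentialForm γ f) ^ (d * (p - 1) / 4) * ∫ x, ‖f x‖ ^ (p + 1) := by
  have hM := mass_pos hf.1.1 hf.2.2
  have hP := potentialForm_pos hd hγ hf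
  set M := ∫ x, ‖f x‖ ^ 2
  set P := potentialForm γ f
  -- These solve 2α - dβ = log(A/M) and 2α - (d-2)β = log(B/P).
  set β : ℝ := (Real.log (B / P) - Real.log (A / M)) / 2 with hβ
  set α : ℝ := (Real.log (A / M) + d * β) / 2 with hα
  refine ⟨rescale α β 1 f, memH1RadNonzero_rescale hf α β 1, ?_, ?_, ?_⟩
  · rw [integral_sq_rescale, show (2 * α - d * β) * 1 = Real.log (A / M) by rw [hα]; ring,
      Real.exp_log (by positivity), div_mul_cancel₀ _ hM.ne']
  · rw [potentialForm_rescale hf.1,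
      show (2 * α - (d - 2) * β) * 1 = Real.log (B / P) by rw [hα, hβ]; ring,
      Real.exp_log (by positivity), div_mul_cancel₀ _ hP.ne']
  · rw [integral_norm_rpow_rescale, Real.rpow_def_of_pos (by positivity),
      Real.rpow_def_of_pos (by positivity), ← Real.exp_add]
    congr 2
    rw [hα, hβ]
    ring

/-- The radial Gagliardo-Nirenberg inequality for `-Δ + γ|x|⁻²`, with an optimizer. -/
theorem exists_gagliardoNirenberg_optimizer {d : ℕ} (hd : 3 ≤ d) {γ : ℝ} (hγ : 0 < γ) {p : ℝ}
    (hp : 1 < p) (hp' : p < 1 + 4 / ((d : ℝ) - 2)) :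
    ∃ C : ℝ, 0 < C ∧
      (∀ f : Space d → ℂ, MemH1RadNonzero f → ∫ x, ‖f x‖ ^ (p + 1) ≤
        C * ((∫ x, ‖f x‖ ^ 2) ^ ((p + 1) / 2 - d * (p - 1) / 4) *
          potentialForm γ f ^ (d * (p - 1) / 4))) ∧
      ∀ A B : ℝ, 0 < A → 0 < B → ∃ g : Space d → ℂ, MemH1RadNonzero g ∧ ∫ x, ‖g x‖ ^ 2 = A ∧
        potentialForm γ g = B ∧ ∫ x, ‖g x‖ ^ (p + 1) =
          C * (A ^ ((p + 1) / 2 - d * (p - 1) / 4) * B ^ (d * (p - 1) / 4)) := by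
  have h3 : (3 : ℝ) ≤ d := by exact_mod_cast hd
  set a : ℝ := (p + 1) / 2 - d * (p - 1) / 4 with ha
  set b : ℝ := d * (p - 1) / 4 with hb
  have ha0 : 0 ≤ a := by linarith [subcritical_exponent hd hp', show a =
    ((d : ℝ) + -(((d : ℝ) - 2) / 2) * (p + 1)) / 2 by rw [ha]; ring]
  have hb0 : 0 ≤ b := by rw [hb]; apply div_nonneg (mul_nonneg _ _) <;> linarith
  set S : Set ℝ := {t | ∃ f : Space d → ℂ, MemH1RadNonzero f ∧ ∫ x, ‖f x‖ ^ 2 = 1 ∧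
    potentialForm γ f = 1 ∧ ∫ x, ‖f x‖ ^ (p + 1) = t} with hS
  obtain ⟨f₀, hf₀⟩ := exists_memH1RadNonzero d
  obtain ⟨f₁, hf₁, hM₁, hP₁, -⟩ := exists_rescale hd hγ hf₀ one_pos one_pos p
  have hne : S.Nonempty := ⟨_, f₁, hf₁, hM₁, hP₁, rfl⟩
  have hbdd : BddAbove S := by
    obtain ⟨B, hB⟩ := exists_bound_of_normalized hd hγ hp hp'
    refine ⟨B, ?_⟩
    rintro t ⟨f, hf, hM, hP, rfl⟩
    exact hB f hf.1 hf.2.1 hM hP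
  set C := sSup S with hC
  have hC0 : 0 < C := by
    refine lt_of_lt_of_le ?_ (le_csSup hbdd ⟨f₁, hf₁, hM₁, hP₁, rfl⟩)
    refine lt_of_le_of_ne (integral_nonneg fun _ => by positivity) fun h => hf₁.2.2 ?_
    have hi := integrable_norm_rpow hd hp hp' hf₁.1.1 (Real.sqrt_nonneg _)
      (ae_norm_le_of_energy_le_one hd hf₁.1 hf₁.2.1
        ((integral_sq_weakGradient_le hγ f₁).trans hP₁.le))
    have h2 := (integral_eq_zero_iff_of_nonneg (fun x => by positivity) hi).1 h.symm
    filter_upwards [h2] with x hx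
    have := (Real.rpow_eq_zero (norm_nonneg _) (by linarith)).1 hx
    simpa using this
  have hGN : ∀ f : Space d → ℂ, MemH1RadNonzero f → ∫ x, ‖f x‖ ^ (p + 1) ≤
        C * ((∫ x, ‖f x‖ ^ 2) ^ a * potentialForm γ f ^ b) := by
    intro f hf
    have hM := mass_pos hf.1.1 hf.2.2
    have hP := potentialForm_pos hd hγ hf
    obtain ⟨g, hg, hgM, hgP, hgN⟩ := exists_rescale hd hγ hf one_pos one_pos p
    have h1 := le_csSup hbdd ⟨g, hg, hgM, hgP, rfl⟩
    rw [hgN, ← ha, ← hb, one_div, one_div, Real.inv_rpow hM.le, Real.inv_rpow hP.le, ← mul_inv,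
      inv_mul_le_iff₀ (by positivity)] at h1
    rwa [mul_comm C]
  refine ⟨C, hC0, hGN, fun A B hA hB => ?_⟩
  obtain ⟨t, -, ht, htS⟩ := exists_seq_tendsto_sSup hne hbdd
  choose f hf hM hP hN using htS
  obtain ⟨q, hq, hqr, hqM, hqP, hqN⟩ := exists_limit_of_normalized hd hγ hp hp'
    (fun n => (hf n).1) (fun n => (hf n).2.1) hM hP (s := C) (by simpa only [hN] using ht)
  have hq0 : MemH1RadNonzero q := by
    refine ⟨hq, hqr, fun h0 => ?_⟩
    have : ∫ x, ‖q x‖ ^ (p + 1) = ∫ _x : Space d, (0 : ℝ) := by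
      refine integral_congr_ae ?_
      filter_upwards [h0] with x hx
      simp [hx, Real.zero_rpow (by linarith : p + 1 ≠ 0)]
    rw [this, integral_zero] at hqN
    linarith
  have hM' := mass_pos hq0.1.1 hq0.2.2
  have hP' := potentialForm_pos hd hγ hq0
  -- Loss of mass or energy does no harm: since a, b ≥ 0, the inequality gives N(q) ≤ C M^a P^b ≤ C,
  -- while N(q) ≥ C, so equality holds throughout.
  have h1 : (∫ x, ‖q x‖ ^ 2) ^ a * potentialForm γ q ^ b ≤ 1 :=
    mul_le_one₀ (Real.rpow_le_one hM'.le hqM ha0) (by positivity)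
      (Real.rpow_le_one hP'.le hqP hb0)
  have hopt : ∫ x, ‖q x‖ ^ (p + 1) = C * ((∫ x, ‖q x‖ ^ 2) ^ a * potentialForm γ q ^ b) :=
    le_antisymm (hGN q hq0) ((mul_le_of_le_one_right hC0.le h1).trans hqN)
  obtain ⟨g, hg, hgM, hgP, hgN⟩ := exists_rescale hd hγ hq0 hA hB p
  refine ⟨g, hg, hgM, hgP, ?_⟩
  rw [hgN, ← ha, ← hb, hopt, Real.div_rpow hA.le hM'.le, Real.div_rpow hB.le hP'.le]
  have e1 := (Real.rpow_pos_of_pos hM' a).ne'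
  have e2 := (Real.rpow_pos_of_pos hP' b).ne'
  field_simp

end NLKG

/-! ### Two-variable minimization -/

namespace NLKG

/-- Weighted AM-GM applied to s/t and 1; t is the point where the line touches the multiple of the
concave power. -/
theorem exists_tangent_rpow {k l θ : ℝ} (hk : 0 < k) (hl : 0 < l) (h0 : 0 < θ) (h1 : θ < 1) :
    ∃ t E : ℝ, 0 < t ∧ 0 < E ∧ k + l * t = E * t ^ θ ∧ ∀ s : ℝ, 0 < s → E * s ^ θ ≤ k + l * s := by
  have h1' : 0 < 1 - θ := by linarith
  have ht : 0 < θ * k / ((1 - θ) * l) := by positivity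
  set t : ℝ := θ * k / ((1 - θ) * l) with ht'
  have htθ := Real.rpow_pos_of_pos ht θ
  have e : k + l * t = k / (1 - θ) := by rw [ht']; field_simp; ring
  refine ⟨t, (k / (1 - θ)) / t ^ θ, ht, by positivity, ?_, fun s hs => ?_⟩
  · rw [e, div_mul_cancel₀ _ htθ.ne']
  · have h2 := Real.geom_mean_le_arith_mean2_weighted h0.le h1'.le (div_pos hs ht).le zero_le_one
      (by ring)
    rw [Real.one_rpow, mul_one, mul_one, Real.div_rpow hs.le ht.le] at h2
    calc k / (1 - θ) / t ^ θ * s ^ θ = k / (1 - θ) * (s ^ θ / t ^ θ) := by ring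
      _ ≤ k / (1 - θ) * (θ * (s / t) + (1 - θ)) := by gcongr
      _ = k + l * s := by rw [ht']; field_simp; ring

theorem rpow_mul_rpow_eq {M s a b : ℝ} (hM : 0 < M) (hs : 0 < s) :
    M ^ a * (s * M) ^ b = M * (M ^ (a + b - 1) * s ^ b) := by
  rw [Real.mul_rpow hs.le hM.le, Real.rpow_sub_one hM.ne', Real.rpow_add hM]
  field_simp

/-- With s = P/M the condition reads k + l s ≤ D M^(a+b-1) s^b. The tangent inequality gives
M^(a+b-1) ≥ E/D, with equality at the tangency ratio. The condition is an inequality because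
Gagliardo-Nirenberg gives no more for a general competitor. -/
theorem exists_min_first {a b k l D : ℝ} (hb : 0 < b) (hb1 : b < 1) (hab : 1 < a + b)
    (hk : 0 < k) (hl : 0 < l) (hD : 0 < D) :
    ∃ A B : ℝ, 0 < A ∧ 0 < B ∧ k * A + l * B = D * (A ^ a * B ^ b) ∧
      ∀ M P : ℝ, 0 < M → 0 < P → k * M + l * P ≤ D * (M ^ a * P ^ b) → A ≤ M := by
  obtain ⟨t, E, ht, hE, htE, hmin⟩ := exists_tangent_rpow hk hl hb hb1
  have hc : 0 < a + b - 1 := by linarith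
  have hA : 0 < (E / D) ^ (1 / (a + b - 1)) := by positivity
  set A := (E / D) ^ (1 / (a + b - 1)) with hA'
  have hAc : A ^ (a + b - 1) = E / D := by
    rw [hA', ← Real.rpow_mul (by positivity), one_div_mul_cancel hc.ne', Real.rpow_one]
  refine ⟨A, t * A, hA, by positivity, ?_, fun M P hM hP h => ?_⟩
  · rw [rpow_mul_rpow_eq hA ht, hAc]
    have : k * A + l * (t * A) = A * (k + l * t) := by ring
    rw [this, htE]
    field_simp
  · have hs : 0 < P / M := by positivity
    have hsb := Real.rpow_pos_of_pos hs b
    have e : P = P / M * M := by field_simp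
    have e2 : M ^ a * P ^ b = M * (M ^ (a + b - 1) * (P / M) ^ b) := by
      rw [← rpow_mul_rpow_eq hM hs, ← e]
    rw [e2] at h
    have e3 : k * M + l * P = M * (k + l * (P / M)) := by field_simp
    rw [e3] at h
    have h2 : M * (E * (P / M) ^ b) ≤ M * (D * M ^ (a + b - 1) * (P / M) ^ b) :=
      (mul_le_mul_of_nonneg_left (hmin _ hs) hM.le).trans (h.trans_eq (by ring))
    have h3 := le_of_mul_le_mul_right (le_of_mul_le_mul_left h2 hM) hsb
    refine (Real.rpow_le_rpow_iff hA.le hM.le hc).1 ?_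
    rw [hAc, div_le_iff₀ hD]
    linarith

/-- For b = 1 the factor P cancels, leaving M^a ≥ 1/D, and P has no weight in the objective. For b >
1, with s = P/M, the condition bounds M s^θ from below for θ = (b-1)/(a+b-1), while the objective
M(m + κs) dominates E M s^θ. -/
theorem exists_min_sum {a b m κ D : ℝ} (ha : 0 < a) (hb : 1 ≤ b) (hm : 0 < m)
    (hκ1 : b = 1 → κ = 0) (hκ : 1 < b → 0 < κ) (hD : 0 < D) :
    ∃ A B : ℝ, 0 < A ∧ 0 < B ∧ B = D * (A ^ a * B ^ b) ∧
      ∀ M P : ℝ, 0 < M → 0 < P → P ≤ D * (M ^ a * P ^ b) → m * A + κ * B ≤ m * M + κ * P := by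
  rcases hb.eq_or_lt with h | h
  · subst h
    rw [hκ1 rfl]
    have hA : 0 < D⁻¹ ^ (1 / a) := by positivity
    set A := D⁻¹ ^ (1 / a) with hA'
    have hAa : A ^ a = D⁻¹ := by
      rw [hA', ← Real.rpow_mul (by positivity), one_div_mul_cancel ha.ne', Real.rpow_one]
    -- The value of B is immaterial in the mass-critical case.
    refine ⟨A, 1, hA, one_pos, ?_, fun M P hM hP h => ?_⟩
    · rw [hAa]; simp [hD.ne']
    · rw [Real.rpow_one, ← mul_assoc] at h
      have h1 : 1 ≤ D * M ^ a := by
        by_contra hlt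
        exact absurd h (not_le.2 (mul_lt_of_lt_one_left hP (not_le.1 hlt)))
      have h2 : A ≤ M := by
        refine (Real.rpow_le_rpow_iff hA.le hM.le ha).1 ?_
        rw [hAa, inv_le_iff_one_le_mul₀ hD, mul_comm]
        exact h1
      nlinarith
  · have hb1 : 0 < b - 1 := by linarith
    have hc : 0 < a + b - 1 := by linarith
    obtain ⟨t, E, ht, hE, htE, hmin⟩ := exists_tangent_rpow (θ := (b - 1) / (a + b - 1)) hm (hκ h)
      (by positivity) (by rw [div_lt_one hc]; linarith)
    have htb := Real.rpow_pos_of_pos ht (b - 1)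
    have hA : 0 < (D * t ^ (b - 1))⁻¹ ^ (1 / (a + b - 1)) := by positivity
    set A := (D * t ^ (b - 1))⁻¹ ^ (1 / (a + b - 1)) with hA'
    have hAc : A ^ (a + b - 1) = (D * t ^ (b - 1))⁻¹ := by
      rw [hA', ← Real.rpow_mul (by positivity), one_div_mul_cancel hc.ne', Real.rpow_one]
    have hpow : ∀ x y : ℝ, 0 < x → 0 < y → (x * y ^ ((b - 1) / (a + b - 1))) ^ (a + b - 1) =
        x ^ (a + b - 1) * y ^ (b - 1) := by
      intro x y hx hy
      rw [Real.mul_rpow hx.le (by positivity), ← Real.rpow_mul hy.le, div_mul_cancel₀ _ hc.ne']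
    refine ⟨A, t * A, hA, by positivity, ?_, fun M P hM hP hle => ?_⟩
    · rw [rpow_mul_rpow_eq hA ht, hAc]
      rw [Real.rpow_sub_one ht.ne'] at htb ⊢
      have := (Real.rpow_pos_of_pos ht b).ne'
      field_simp
    · have hs : 0 < P / M := by positivity
      have e : P = P / M * M := by field_simp
      have e2 : M ^ a * P ^ b = P * (M ^ (a + b - 1) * (P / M) ^ (b - 1)) := by
        have : M ^ a * P ^ b = M * (M ^ (a + b - 1) * (P / M) ^ b) := by
          rw [← rpow_mul_rpow_eq hM hs, ← e]
        rw [this, Real.rpow_sub_one hs.ne']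
        field_simp
      rw [e2] at hle
      have h1 : D⁻¹ ≤ M ^ (a + b - 1) * (P / M) ^ (b - 1) := by
        rw [inv_le_iff_one_le_mul₀ hD]
        by_contra hlt
        have := mul_lt_of_lt_one_right hP (not_le.1 hlt)
        linarith
      have h2 : A * t ^ ((b - 1) / (a + b - 1)) ≤ M * (P / M) ^ ((b - 1) / (a + b - 1)) := by
        refine (Real.rpow_le_rpow_iff (by positivity) (by positivity) hc).1 ?_
        rw [hpow A t hA ht, hpow M _ hM hs, hAc]
        refine le_trans (le_of_eq ?_) h1
        field_simp
      calc m * A + κ * (t * A) = A * (m + κ * t) := by ring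
        _ = E * (A * t ^ ((b - 1) / (a + b - 1))) := by rw [htE]; ring
        _ ≤ E * (M * (P / M) ^ ((b - 1) / (a + b - 1))) := by gcongr
        _ = M * (E * (P / M) ^ ((b - 1) / (a + b - 1))) := by ring
        _ ≤ M * (m + κ * (P / M)) := by
          have := hmin _ hs
          gcongr
        _ = m * M + κ * P := by field_simp

/-! ### The three constraints -/

theorem isRadialMinimizer_of_forall_le {d : ℕ} {p ω γ α β : ℝ} {φ : Space d → ℂ}
    (h : φ ∈ constraintSet d p ω γ α β)
    (hle : ∀ ψ ∈ constraintSet d p ω γ α β, action p ω γ φ ≤ action p ω γ ψ) :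
    IsRadialMinimizer p ω γ α β φ := by
  have hl : IsLeast (action p ω γ '' constraintSet d p ω γ α β) (action p ω γ φ) :=
    ⟨⟨φ, h, rfl⟩, by rintro _ ⟨ψ, hψ, rfl⟩; exact hle ψ hψ⟩
  have e : radialInf d p ω γ α β = action p ω γ φ := hl.csInf_eq
  exact ⟨h, e.symm, fun ψ hψ => e.le.trans (hle ψ hψ)⟩

theorem mem_constraintSet_iff {d : ℕ} {p ω γ α β : ℝ} {φ : Space d → ℂ} :
    φ ∈ constraintSet d p ω γ α β ↔ MemH1RadNonzero φ ∧
      (1 - ω ^ 2) / 2 * (2 * α - d * β) * (∫ x, ‖φ x‖ ^ 2)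
        + 1 / 2 * (2 * α - (d - 2) * β) * potentialForm γ φ
        - 1 / (p + 1) * ((p + 1) * α - d * β) * ∫ x, ‖φ x‖ ^ (p + 1) = 0 := by
  refine and_congr_right fun h => ?_
  rw [virial, (hasDerivAt_action_rescale h.1 p ω γ α β).deriv]

/-- For (d, 2) the mass drops out of the constraint, which becomes P = 2b/(p+1) N. The action is
then a positive multiple of M plus (1/2 - 1/(2b)) P. The last coefficient is nonnegative because b ≥
1, and vanishes at p = 1 + 4/d. -/
theorem exists_minimizer_supercritical {d : ℕ} (hd : 3 ≤ d) {p γ ω : ℝ} (hγ : 0 < γ)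
    (hω : 0 < 1 - ω ^ 2) (hp : 1 + 4 / (d : ℝ) ≤ p) (hp' : p < 1 + 4 / ((d : ℝ) - 2)) :
    ∃ φ : Space d → ℂ, IsRadialMinimizer p ω γ (d : ℝ) 2 φ := by
  have h3 : (3 : ℝ) ≤ d := by exact_mod_cast hd
  have hd0 : (0 : ℝ) < d := by linarith
  have hp1 : 1 < p := lt_of_lt_of_le (by linarith [div_pos four_pos hd0]) hp
  obtain ⟨C, hC, hGN, hopt⟩ := exists_gagliardoNirenberg_optimizer hd hγ hp1 hp'
  have ha : 0 < (p + 1) / 2 - d * (p - 1) / 4 := by linarith [subcritical_exponent hd hp']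
  have hb : 1 ≤ d * (p - 1) / 4 := by
    rw [le_div_iff₀ four_pos, one_mul, mul_comm, ← div_le_iff₀ hd0]
    linarith
  set a := (p + 1) / 2 - d * (p - 1) / 4
  set b := d * (p - 1) / 4 with hb'
  have hb0 : 0 < b := by linarith
  have hD : 0 < 2 * b / (p + 1) * C := by positivity
  have hcon : ∀ φ : Space d → ℂ, φ ∈ constraintSet d p ω γ d 2 ↔ MemH1RadNonzero φ ∧
      potentialForm γ φ = 2 * b / (p + 1) * ∫ x, ‖φ x‖ ^ (p + 1) := by
    intro φ
    rw [mem_constraintSet_iff]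
    refine and_congr_right fun _ => ?_
    have e : 1 / (p + 1) * ((p + 1) * d - d * 2) = 2 * (2 * b / (p + 1)) := by
      rw [hb']; ring
    rw [e]
    constructor <;> intro h <;> linarith
  have hact : ∀ φ ∈ constraintSet d p ω γ d 2, action p ω γ φ =
      (1 - ω ^ 2) / 2 * (∫ x, ‖φ x‖ ^ 2) + (1 / 2 - 1 / (2 * b)) * potentialForm γ φ := by
    intro φ hφ
    have h := ((hcon φ).1 hφ).2
    have e : 1 / (p + 1) * ∫ x, ‖φ x‖ ^ (p + 1) = 1 / (2 * b) * potentialForm γ φ := by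
      rw [h]; field_simp
    rw [action, e]
    ring
  obtain ⟨A, B, hA, hB, hAB, hmin⟩ := exists_min_sum (κ := 1 / 2 - 1 / (2 * b)) ha hb
    (half_pos hω) (fun h => by rw [h]; norm_num) (fun h => by
      rw [sub_pos, div_lt_div_iff₀ (by positivity) two_pos]; linarith) hD
  obtain ⟨g, hg, hgM, hgP, hgN⟩ := hopt A B hA hB
  have hgc : g ∈ constraintSet d p ω γ d 2 := by
    rw [hcon, hgP, hgN, ← mul_assoc]
    exact ⟨hg, hAB⟩
  refine ⟨g, isRadialMinimizer_of_forall_le hgc fun ψ hψ => ?_⟩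
  rw [hact g hgc, hact ψ hψ, hgM, hgP]
  obtain ⟨hψ1, hψ2⟩ := (hcon ψ).1 hψ
  refine hmin _ _ (mass_pos hψ1.1.1 hψ1.2.2) (potentialForm_pos hd hγ hψ1) ?_
  calc potentialForm γ ψ = _ := hψ2
    _ ≤ _ := by
      rw [mul_assoc]
      exact mul_le_mul_of_nonneg_left (hGN ψ hψ1) (by positivity)

/-- For (2, p-1) the scaling weights of P and N agree, as 4 - (d-2)(p-1) = 2(p+1) - d(p-1).
Eliminating N thus eliminates P as well, and the action is a nonnegative multiple of the mass. -/
theorem exists_minimizer_subcritical_mass {d : ℕ} (hd : 3 ≤ d) {p γ ω : ℝ} (hγ : 0 < γ)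
    (hω : 0 < 1 - ω ^ 2) (hp1 : 1 < p) (hp : d * (p - 1) < 4)
    (hp' : p < 1 + 4 / ((d : ℝ) - 2)) :
    ∃ φ : Space d → ℂ, IsRadialMinimizer p ω γ 2 (p - 1) φ := by
  have h3 : (3 : ℝ) ≤ d := by exact_mod_cast hd
  obtain ⟨C, hC, hGN, hopt⟩ := exists_gagliardoNirenberg_optimizer hd hγ hp1 hp'
  set a := (p + 1) / 2 - d * (p - 1) / 4 with ha'
  set b := d * (p - 1) / 4 with hb'
  have hb0 : 0 < b := by rw [hb']; apply div_pos (mul_pos _ _) <;> linarith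
  have hb1 : b < 1 := by rw [hb']; linarith
  have hab : 1 < a + b := by rw [ha', hb']; linarith
  have hu : 0 < 4 - d * (p - 1) := by linarith
  have hv : 0 < 4 - (d - 2) * (p - 1) := by nlinarith
  set k := (1 - ω ^ 2) / 2 * ((4 - d * (p - 1)) / (4 - (d - 2) * (p - 1))) with hk'
  have hk : 0 < k := by positivity
  have hkm : k ≤ (1 - ω ^ 2) / 2 := by
    refine mul_le_of_le_one_right (half_pos hω).le ?_
    rw [div_le_one hv]
    nlinarith
  have hcon : ∀ φ : Space d → ℂ, φ ∈ constraintSet d p ω γ 2 (p - 1) ↔ MemH1RadNonzero φ ∧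
      k * (∫ x, ‖φ x‖ ^ 2) + 1 / 2 * potentialForm γ φ =
        1 / (p + 1) * ∫ x, ‖φ x‖ ^ (p + 1) := by
    intro φ
    rw [mem_constraintSet_iff]
    refine and_congr_right fun _ => ?_
    have e : (1 - ω ^ 2) / 2 * (2 * 2 - d * (p - 1)) * (∫ x, ‖φ x‖ ^ 2)
        + 1 / 2 * (2 * 2 - (d - 2) * (p - 1)) * potentialForm γ φ
        - 1 / (p + 1) * ((p + 1) * 2 - d * (p - 1)) * ∫ x, ‖φ x‖ ^ (p + 1) =
        (4 - (d - 2) * (p - 1)) * (k * (∫ x, ‖φ x‖ ^ 2) + 1 / 2 * potentialForm γ φ -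
        1 / (p + 1) * ∫ x, ‖φ x‖ ^ (p + 1)) := by
      have : (4 - (d - 2) * (p - 1)) * k = (1 - ω ^ 2) / 2 * (4 - d * (p - 1)) := by
        rw [hk']; field_simp
      linear_combination -(∫ x, ‖φ x‖ ^ 2) * this
    rw [e, mul_eq_zero, or_iff_right hv.ne', sub_eq_zero]
  have hact : ∀ φ ∈ constraintSet d p ω γ 2 (p - 1), action p ω γ φ =
      ((1 - ω ^ 2) / 2 - k) * (∫ x, ‖φ x‖ ^ 2) := by
    intro φ hφ
    have h := ((hcon φ).1 hφ).2
    rw [action, ← h]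
    ring
  obtain ⟨A, B, hA, hB, hAB, hmin⟩ := exists_min_first hb0 hb1 hab hk (half_pos one_pos)
    (show 0 < 1 / (p + 1) * C by positivity)
  obtain ⟨g, hg, hgM, hgP, hgN⟩ := hopt A B hA hB
  have hgc : g ∈ constraintSet d p ω γ 2 (p - 1) := by
    rw [hcon, hgM, hgP, hgN, ← mul_assoc]
    exact ⟨hg, hAB⟩
  refine ⟨g, isRadialMinimizer_of_forall_le hgc fun ψ hψ => ?_⟩
  rw [hact g hgc, hact ψ hψ, hgM]
  obtain ⟨hψ1, hψ2⟩ := (hcon ψ).1 hψ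
  refine mul_le_mul_of_nonneg_left ?_ (by linarith)
  refine hmin _ _ (mass_pos hψ1.1.1 hψ1.2.2) (potentialForm_pos hd hγ hψ1) ?_
  rw [hψ2, mul_assoc]
  exact mul_le_mul_of_nonneg_left (hGN ψ hψ1) (by positivity)

/-- For (0, -1), the Pohozaev constraint, eliminating N removes the mass and leaves the action P/d.
The planar problem is the one for the mass with M and P exchanged; it applies since 0 < a < 1, where
a < 1 because d > 2. -/
theorem exists_minimizer_subcritical_energy {d : ℕ} (hd : 3 ≤ d) {p γ ω : ℝ} (hγ : 0 < γ)
    (hω : 0 < 1 - ω ^ 2) (hp1 : 1 < p) (hp' : p < 1 + 4 / ((d : ℝ) - 2)) :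
    ∃ φ : Space d → ℂ, IsRadialMinimizer p ω γ 0 (-1) φ := by
  have h3 : (3 : ℝ) ≤ d := by exact_mod_cast hd
  have hd0 : (0 : ℝ) < d := by linarith
  have hd2 : (0 : ℝ) < d - 2 := by linarith
  obtain ⟨C, hC, hGN, hopt⟩ := exists_gagliardoNirenberg_optimizer hd hγ hp1 hp'
  have ha0 : 0 < (p + 1) / 2 - d * (p - 1) / 4 := by linarith [subcritical_exponent hd hp']
  have ha1 : (p + 1) / 2 - d * (p - 1) / 4 < 1 := by nlinarith
  set a := (p + 1) / 2 - d * (p - 1) / 4 with ha'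
  set b := d * (p - 1) / 4 with hb'
  have hab : 1 < b + a := by rw [ha', hb']; linarith
  have hcon : ∀ φ : Space d → ℂ, φ ∈ constraintSet d p ω γ 0 (-1) ↔ MemH1RadNonzero φ ∧
      (d - 2) / 2 * potentialForm γ φ + (1 - ω ^ 2) / 2 * d * (∫ x, ‖φ x‖ ^ 2) =
        d / (p + 1) * ∫ x, ‖φ x‖ ^ (p + 1) := by
    intro φ
    rw [mem_constraintSet_iff]
    refine and_congr_right fun _ => ?_
    have e : 1 / (p + 1) * ((p + 1) * 0 - d * (-1)) = d / (p + 1) := by ring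
    rw [e]
    constructor <;> intro h <;> linarith
  have hact : ∀ φ ∈ constraintSet d p ω γ 0 (-1), action p ω γ φ = 1 / d * potentialForm γ φ := by
    intro φ hφ
    have h := ((hcon φ).1 hφ).2
    have e : 1 / (p + 1) * ∫ x, ‖φ x‖ ^ (p + 1) =
        1 / d * (d / (p + 1) * ∫ x, ‖φ x‖ ^ (p + 1)) := by field_simp
    rw [action, e, ← h]
    field_simp
    ring
  obtain ⟨B, A, hB, hA, hAB, hmin⟩ := exists_min_first ha0 ha1 hab (half_pos hd2)
    (show 0 < (1 - ω ^ 2) / 2 * d by positivity) (show 0 < d / (p + 1) * C by positivity)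
  obtain ⟨g, hg, hgM, hgP, hgN⟩ := hopt A B hA hB
  have hgc : g ∈ constraintSet d p ω γ 0 (-1) := by
    rw [hcon, hgM, hgP, hgN, ← mul_assoc, mul_comm (A ^ a)]
    exact ⟨hg, hAB⟩
  refine ⟨g, isRadialMinimizer_of_forall_le hgc fun ψ hψ => ?_⟩
  rw [hact g hgc, hact ψ hψ, hgP]
  obtain ⟨hψ1, hψ2⟩ := (hcon ψ).1 hψ
  refine mul_le_mul_of_nonneg_left ?_ (by positivity)
  refine hmin _ _ (potentialForm_pos hd hγ hψ1) (mass_pos hψ1.1.1 hψ1.2.2) ?_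
  rw [hψ2, mul_assoc, mul_comm (_ ^ b)]
  exact mul_le_mul_of_nonneg_left (hGN ψ hψ1) (by positivity)

end NLKG

theorem mainTheorem6 (d : ℕ) (hd : 3 ≤ d) (p γ ω : ℝ) (hγ : 0 < γ) (hω : |ω| < 1) :
    ((1 + 4 / (d : ℝ) ≤ p ∧ p < 1 + 4 / ((d : ℝ) - 2)) →
      ∃ φ : NLKG.Space d → ℂ, NLKG.IsRadialMinimizer p ω γ (d : ℝ) 2 φ) ∧
    ((1 < p ∧ p < 1 + 4 / (d : ℝ)) →
      (∃ φ : NLKG.Space d → ℂ, NLKG.IsRadialMinimizer p ω γ 2 (p - 1) φ) ∧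
      (∃ φ : NLKG.Space d → ℂ, NLKG.IsRadialMinimizer p ω γ 0 (-1) φ)) := by
  have h3 : (3 : ℝ) ≤ d := by exact_mod_cast hd
  have hd0 : (0 : ℝ) < d := by linarith
  have hω' : 0 < 1 - ω ^ 2 := sub_pos.2 ((sq_lt_one_iff_abs_lt_one ω).2 hω)
  refine ⟨fun h => NLKG.exists_minimizer_supercritical hd hγ hω' h.1 h.2, fun h => ?_⟩
  have hp : d * (p - 1) < 4 := by
    rw [mul_comm, ← lt_div_iff₀ hd0]
    linarith [h.2]
  have hp' : p < 1 + 4 / ((d : ℝ) - 2) :=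
    h.2.trans (by gcongr <;> linarith)
  exact ⟨NLKG.exists_minimizer_subcritical_mass hd hγ hω' h.1 hp hp',
    NLKG.exists_minimizer_subcritical_energy hd hγ hω' h.1 hp'⟩
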